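/- Let $\Gamma$ be the graph with vertex set $\mathbb{Z}_+=\{0,1,2,\dots\}$ whose edges join nearest neighbours. For $\alpha\in(-\infty,2)$ give the edge $\{n,n+1\}$ the weight $\pi_\alpha(n,n+1)=(n+1)^2\log_+^\alpha(n+1)$, where $\log_+(x)=\max(\log x,1)$. Let $$(\mathcal{L}_{\mathbb 1}f)(n)=\sum_{m\sim n}\pi_\alpha(n,m)\,(f(m)-f(n)),\qquad \mathcal{D}(\mathcal{L}_{\mathbb 1})=\{f\in\ell^2(\mathbb{Z}_+):\mathcal{L}_{\mathbb 1}f\in\ell^2(\mathbb{Z}_+)\},$$ be the corresponding (unbounded) Laplacian on the real Hilbert space $\ell^2(\mathbb{Z}_+)$. Let $\lambda_0(\alpha)$ be the infimum of the spectrum of $-\mathcal{L}_{\mathbb 1}$, and let $\lambda_0^{ess}(\alpha)$ be the infimum of its essential spectrum, that is, of the set of points of the spectrum that are accumulation points of the spectrum or eigenvalues of infinite multiplicity (with $\inf\varnothing=+\infty$). Then: 1. For every finitely supported $f:\mathbb{Z}_+\to\mathbb{R}$, $$\sum_{n\ge 0}(n+1)^2\,(f(n)-f(n+1))^2\ \ge\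 \frac19\sum_{n\ge 0}f(n)^2 .$$ 2. If $\alpha=0$, then $\frac19\le\lambda_0(0)\le\lambda_0^{ess}(0)\le\frac14$. 3. If $0<\alpha<2$, then the essential spectrum of $-\mathcal{L}_{\mathbb 1}$ is empty. 4. If $\alpha<0$, then $\lambda_0^{ess}(\alpha)=0$. -/

import Mathlib

noncomputable section

namespace GraphLaplacian

/-! ### Spectrum of an unbounded operator on a real Hilbert space -/

section Spectrum

variable {H : Type*} [NormedAddCommGroup H] [InnerProductSpace ℝ H]

/-- The (real) resolvent set of an unbounded operator `T`: the `z` for which `T - z` is a bijection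
from the domain of `T` onto the whole space with bounded inverse `R`. -/
def resolventSet (T : H →ₗ.[ℝ] H) : Set ℝ :=
  {z | ∃ R : H →L[ℝ] H,
    (∀ g : H, ∃ h : R g ∈ T.domain, T ⟨R g, h⟩ - z • R g = g) ∧
    (∀ f : T.domain, R (T f - z • (f : H)) = f)}

/-- The spectrum of an unbounded operator. -/
def spectrum (T : H →ₗ.[ℝ] H) : Set ℝ := (resolventSet T)ᶜ

/-- The eigenspace `ker (T - z)`, inside the domain of `T`. -/
def eigenspace (T : H →ₗ.[ℝ] H) (z : ℝ) : Submodule ℝ T.domain :=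
  LinearMap.ker (T.toFun - z • T.domain.subtype)

/-- The essential spectrum: the points of the spectrum which are accumulation points of the
spectrum or eigenvalues of infinite multiplicity. -/
def essSpectrum (T : H →ₗ.[ℝ] H) : Set ℝ :=
  {z | z ∈ spectrum T ∧
    (AccPt z (Filter.principal (spectrum T)) ∨ ¬ FiniteDimensional ℝ (eigenspace T z))}

/-- The bottom of a set of reals, as an extended real; it is `+∞` for the empty set. -/
def bottom (S : Set ℝ) : EReal := sInf ((fun x : ℝ => (x : EReal)) '' S)

end Spectrum

/-! ### The Laplacian of a weighted graph, with respect to the counting measure -/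

section Laplacian

variable {V : Type*}

/-- The formal Laplacian `(L f)(x) = ∑_{y ∼ x} w x y * (f y - f x)`. -/
def laplacian (G : SimpleGraph V) [G.LocallyFinite] (w : V → V → ℝ) :
    (V → ℝ) →ₗ[ℝ] (V → ℝ) where
  toFun f x := ∑ y ∈ G.neighborFinset x, w x y * (f y - f x)
  map_add' f g := by
    funext x
    simp only [Pi.add_apply]
    rw [← Finset.sum_add_distrib]
    exact Finset.sum_congr rfl fun y _ => by ring
  map_smul' c f := by
    funext x
    simp only [Pi.smul_apply, smul_eq_mul, RingHom.id_apply]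
    rw [Finset.mul_sum]
    exact Finset.sum_congr rfl fun y _ => by ring

/-- The operator `-L` on `ℓ²(V)`, with domain `{f ∈ ℓ² : L f ∈ ℓ²}`. -/
def negLaplacian (G : SimpleGraph V) [G.LocallyFinite] (w : V → V → ℝ) :
    lp (fun _ : V => ℝ) 2 →ₗ.[ℝ] lp (fun _ : V => ℝ) 2 where
  domain :=
    { carrier := {f | Memℓp (laplacian G w (f : V → ℝ)) 2}
      add_mem' := by
        intro f g hf hg
        have h : laplacian G w ((f + g : lp (fun _ : V => ℝ) 2) : V → ℝ)
            = laplacian G w (f : V → ℝ) + laplacian G w (g : V → ℝ) := by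
          rw [lp.coeFn_add, map_add]
        rw [Set.mem_ofPred_eq, h]
        exact Memℓp.add hf hg
      zero_mem' := by
        rw [Set.mem_ofPred_eq, lp.coeFn_zero, map_zero]
        exact zero_memℓp
      smul_mem' := by
        intro c f hf
        have h : laplacian G w ((c • f : lp (fun _ : V => ℝ) 2) : V → ℝ)
            = c • laplacian G w (f : V → ℝ) := by
          rw [lp.coeFn_smul, map_smul]
        rw [Set.mem_ofPred_eq, h]
        exact Memℓp.const_smul hf c }
  toFun :=
    { toFun := fun f => -⟨laplacian G w ((f : lp (fun _ : V => ℝ) 2) : V → ℝ), f.2⟩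
      map_add' := by
        intro f g
        rw [← neg_add]
        congr 1
        apply Subtype.ext
        exact map_add (laplacian G w) _ _
      map_smul' := by
        intro c f
        rw [RingHom.id_apply, smul_neg]
        congr 1
        apply Subtype.ext
        exact map_smul (laplacian G w) c _ }

end Laplacian

/-! ### The birth-death chain -/

/-- The graph on `ℤ₊ = {0, 1, 2, …}` whose edges join nearest neighbours. -/
def lineGraph : SimpleGraph ℕ where
  Adj m n := n = m + 1 ∨ m = n + 1
  symm := ⟨fun _ _ h => h.symm⟩
  loopless := ⟨fun n h => by omega⟩

instance : lineGraph.LocallyFinite := fun n =>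
  ((Set.finite_Iic (n + 1)).subset fun m (h : m = n + 1 ∨ n = m + 1) => by
    rw [Set.mem_Iic]; omega).fintype

/-- `log₊ x = max (log x) 1`. -/
def logPlus (x : ℝ) : ℝ := max (Real.log x) 1

/-- The weight `(n+1)² log₊^α (n+1)` of the edge `{n, n+1}`. -/
def edgeWeight (α : ℝ) (n : ℕ) : ℝ := ((n : ℝ) + 1) ^ 2 * logPlus ((n : ℝ) + 1) ^ α

/-- The symmetric edge weights: `edgeWeight α n` on the pairs `(n, n+1)` and `(n+1, n)`, and `0` on
the pairs that are not edges. -/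
def weight (α : ℝ) (m n : ℕ) : ℝ :=
  if n = m + 1 then edgeWeight α m else if m = n + 1 then edgeWeight α n else 0

/-- The operator `-L` on `ℓ²(ℤ₊)` of the birth-death chain with parameter `α`. -/
def birthDeath (α : ℝ) : lp (fun _ : ℕ => ℝ) 2 →ₗ.[ℝ] lp (fun _ : ℕ => ℝ) 2 :=
  negLaplacian lineGraph (weight α)

/-- The bottom of the spectrum. -/
def lambdaZero (α : ℝ) : EReal := bottom (spectrum (birthDeath α))

/-- The bottom of the essential spectrum (`+∞` if the essential spectrum is empty). -/
def lambdaZeroEss (α : ℝ) : EReal := bottom (essSpectrum (birthDeath α))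

end GraphLaplacian

end

/-!
The operator `T = -L` on its maximal domain is self-adjoint, and every claim about its spectrum is
read off from its quadratic form.

*Self-adjointness* (`isSelfAdjoint_birthDeath`). Summing `T f` over `{0, …, N}` gives the flux
`a_N (f N - f (N + 1))`, which is therefore at most `√(N + 1) ‖T f‖`, while `√(N + 1) |g N|` is
small along a subsequence for every `g ∈ ℓ²`. So the boundary term in Green's formula vanishes along a
subsequence, and `T` is symmetric; testing against finitely supported vectors shows that its adjoint
is contained in it. The same argument gives `∑ a_n (f n - f (n + 1))² ≤ ⟪T f, f⟫`.

*Hardy's inequality* (`hardy_Ico`) holds on every interval, with constant `1/4` and boundary terms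
that are harmless on the left end. On `{0, 1, …}` it gives `T ≥ 1/4` for `α = 0`; on `{N, N + 1, …}`
it bounds the tail of `f` by `4 / log₊^α (N + 1) ⟪T f, f⟫` for `α ≥ 0`.

*Empty essential spectrum for `α > 0`.* The equation `T f - z f = g` is a recursion, so eigenvectors
are determined by their value at `0`. Together with the tail bound, `f 0` and `T f - z f` control
`‖f‖`, whence the spectrum consists of eigenvalues. Unit eigenvectors with bounded eigenvalues are
orthonormal and concentrated on a common finite set, so Bessel's inequality leaves room for finitely
many (`finite_spectrum_inter`).

*Points of the essential spectrum for `α ≤ 0`.* Suppose that `T ≥ m` and that `(m, m + 2r)` does not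
meet the spectrum. Then `(T - m)² ≥ 2r (T - m)` because `‖(T - c)⁻¹‖` is the reciprocal of the
distance from `c` to the spectrum (`norm_le_shift_of_gap`), and a vector `f` is within
`(⟪(T - m) f, f⟫ / 2r)^(1/2)` of the kernel of `T - m` (`exists_ker_of_gap`). That kernel is at most
one-dimensional and controlled by the value at `0`, so vectors with `f 0 = 0` and energy almost `m`
are excluded; if they exist, `m` is an accumulation point of the spectrum
(`mem_essSpectrum_of_energy`). Truncations of `(n + 1)^(-1/2)` are such vectors, with `m = 1/4` for
`α = 0`, and, when supported far from `0`, with `m = 0` for `α < 0`.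
-/

namespace GraphLaplacian

/-! ### Self-adjoint unbounded operators on a real Hilbert space -/

section SelfAdjoint

open Filter Topology
open scoped RealInnerProductSpace

variable {H : Type*} [NormedAddCommGroup H] [InnerProductSpace ℝ H]

/-- The operator `T - z` on the domain of `T`. -/
noncomputable def shift (T : H →ₗ.[ℝ] H) (z : ℝ) : T.domain →ₗ[ℝ] H :=
  T.toFun - z • T.domain.subtype

theorem shift_apply (T : H →ₗ.[ℝ] H) (z : ℝ) (f : T.domain) :
    shift T z f = T f - z • (f : H) := rfl

variable {T : H →ₗ.[ℝ] H}

/-- A bounded inverse of `T - z` bounds `T - z` from below. -/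
theorem bound_of_mem_resolventSet {z : ℝ} (hz : z ∈ resolventSet T) :
    ∃ c > 0, ∀ f : T.domain, c * ‖(f : H)‖ ≤ ‖shift T z f‖ := by
  obtain ⟨R, -, hR⟩ := hz
  refine ⟨(‖R‖ + 1)⁻¹, by positivity, fun f => ?_⟩
  rw [inv_mul_le_iff₀ (by positivity)]
  calc ‖(f : H)‖ = ‖R (shift T z f)‖ := by rw [shift_apply, hR]
    _ ≤ ‖R‖ * ‖shift T z f‖ := R.le_opNorm _
    _ ≤ _ := by nlinarith [norm_nonneg (shift T z f)]

/-- If `T - (c + s)` has a bounded inverse, then so has `R - s⁻¹`, for the resolvent `R` at `c`;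
only the lower bound is needed. -/
theorem resolvent_sub_bound {c s : ℝ} (hs : s ≠ 0) {R : H →L[ℝ] H}
    (hR : ∀ g : H, ∃ h : R g ∈ T.domain, T ⟨R g, h⟩ - c • R g = g)
    (hcs : c + s ∈ resolventSet T) :
    ∃ κ > 0, ∀ x : H, κ * ‖x‖ ≤ ‖R x - s⁻¹ • x‖ := by
  obtain ⟨c', hc', h⟩ := bound_of_mem_resolventSet hcs
  have hs' : 0 < |s| := abs_pos.2 hs
  refine ⟨(|s| * (1 + |s| / c'))⁻¹, by positivity, fun x => ?_⟩
  obtain ⟨hd, hx⟩ := hR x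
  set f : T.domain := ⟨R x, hd⟩ with hf
  have e1 : x = shift T (c + s) f + s • R x := by
    rw [shift_apply, add_smul]
    conv_lhs => rw [← hx]
    show _ = T f - (c • R x + s • R x) + s • R x
    abel
  have e2 : R x - s⁻¹ • x = (-s⁻¹) • shift T (c + s) f := by
    have e3 : shift T (c + s) f = x - s • R x := by
      rw [eq_sub_iff_add_eq]; exact e1.symm
    rw [e3, smul_sub, smul_smul, neg_smul, neg_mul, inv_mul_cancel₀ hs, neg_smul, one_smul]
    abel
  have h1 := h f
  have h2 : ‖x‖ ≤ ‖shift T (c + s) f‖ + |s| * ‖R x‖ := by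
    conv_lhs => rw [e1]
    refine (norm_add_le _ _).trans ?_
    rw [norm_smul, Real.norm_eq_abs]
  have h3 : ‖R x‖ ≤ ‖shift T (c + s) f‖ / c' := by
    rw [le_div_iff₀ hc', mul_comm]; exact h1
  rw [e2, norm_smul, norm_neg, norm_inv, Real.norm_eq_abs, inv_mul_le_iff₀ (by positivity)]
  calc ‖x‖ ≤ ‖shift T (c + s) f‖ + |s| * (‖shift T (c + s) f‖ / c') := by
        refine h2.trans ?_; gcongr
    _ = |s| * (1 + |s| / c') * (|s|⁻¹ * ‖shift T (c + s) f‖) := by field_simp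

variable [CompleteSpace H]

theorem symm_of_isSelfAdjoint (hT : IsSelfAdjoint T) (f g : T.domain) :
    ⟪T f, (g : H)⟫ = ⟪(f : H), T g⟫ := by
  have h := LinearPMap.adjoint_isFormalAdjoint (T := T) hT.dense_domain
  rw [LinearPMap.isSelfAdjoint_def.1 hT] at h
  exact h f g

theorem shift_symm (hT : IsSelfAdjoint T) (z : ℝ) (f g : T.domain) :
    ⟪shift T z f, (g : H)⟫ = ⟪(f : H), shift T z g⟫ := by
  rw [shift_apply, shift_apply, inner_sub_left, inner_sub_right, symm_of_isSelfAdjoint hT,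
    real_inner_smul_left, real_inner_smul_right]

/-- `T - z` is closed. -/
theorem exists_of_tendsto (hT : IsSelfAdjoint T) {z : ℝ} {u : ℕ → T.domain} {f g : H}
    (hf : Tendsto (fun n => (u n : H)) atTop (𝓝 f))
    (hg : Tendsto (fun n => shift T z (u n)) atTop (𝓝 g)) :
    ∃ h : f ∈ T.domain, shift T z ⟨f, h⟩ = g := by
  have hTu : Tendsto (fun n => T (u n)) atTop (𝓝 (g + z • f)) := by
    refine (hg.add (hf.const_smul z)).congr fun n => ?_
    rw [shift_apply, sub_add_cancel]
  have hcl : IsClosed (T.graph : Set (H × H)) := hT.isClosed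
  have hmem := hcl.mem_of_tendsto (hf.prodMk_nhds hTu)
    (Eventually.of_forall fun n => T.mem_graph (u n))
  obtain ⟨y, hy1, hy2⟩ := (T.mem_graph_iff).1 hmem
  subst hy1
  exact ⟨y.2, by rw [shift_apply]; simp [hy2]⟩

/-- The orthogonal complement of the range of `T - z` is the kernel of `T - z`. -/
theorem mem_ker_of_inner_shift_eq_zero (hT : IsSelfAdjoint T) {z : ℝ} {y : H}
    (h : ∀ f : T.domain, ⟪y, shift T z f⟫ = 0) :
    ∃ hy : y ∈ T.domain, shift T z ⟨y, hy⟩ = 0 := by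
  have hw : ∀ x : T.domain, ⟪z • y, (x : H)⟫ = ⟪y, T x⟫ := fun x => by
    have := h x
    rw [shift_apply, inner_sub_right, real_inner_smul_right] at this
    rw [real_inner_smul_left]; linarith
  have hT' := LinearPMap.isSelfAdjoint_def.1 hT
  have hmem : y ∈ T.domain := by
    rw [← hT']; exact LinearPMap.mem_adjoint_domain_of_exists (T := T) y ⟨_, hw⟩
  refine ⟨hmem, ?_⟩
  have : T ⟨y, hmem⟩ - z • y = 0 := by
    refine hT.dense_domain.eq_zero_of_inner_left ℝ fun x hx => ?_
    rw [inner_sub_left, hw ⟨x, hx⟩, symm_of_isSelfAdjoint hT ⟨y, hmem⟩ ⟨x, hx⟩, sub_self]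
  exact this

/-- For a self-adjoint `T`, the operator `T - z` has a bounded inverse as soon as it is bounded
from below: its range is closed because `T` is closed, and dense because its orthogonal complement
is the kernel. -/
theorem mem_resolventSet_of_bound (hT : IsSelfAdjoint T) {z c : ℝ} (hc : 0 < c)
    (h : ∀ f : T.domain, c * ‖(f : H)‖ ≤ ‖shift T z f‖) : z ∈ resolventSet T := by
  have hker : LinearMap.ker (shift T z) = ⊥ := by
    rw [LinearMap.ker_eq_bot']
    intro f hf
    have := h f
    rw [hf, norm_zero] at this
    have h0 : ‖(f : H)‖ ≤ 0 := by nlinarith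
    exact Subtype.ext (norm_le_zero_iff.1 h0)
  have hclosed : IsClosed ((shift T z).range : Set H) := by
    refine IsSeqClosed.isClosed ?_
    intro x p hx hp
    choose u hu using hx
    have hcau : CauchySeq (fun n => (u n : H)) := by
      rw [Metric.cauchySeq_iff']
      intro ε hε
      obtain ⟨N, hN⟩ := Metric.cauchySeq_iff'.1 hp.cauchySeq (c * ε) (by positivity)
      refine ⟨N, fun n hn => ?_⟩
      have h1 := h (u n - u N)
      rw [map_sub, hu, hu, ← dist_eq_norm] at h1
      have h2 := h1.trans_lt (hN n hn)
      rw [dist_eq_norm]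
      exact lt_of_mul_lt_mul_left h2 hc.le
    obtain ⟨f, hf⟩ := cauchySeq_tendsto_of_complete hcau
    obtain ⟨hfd, hfe⟩ := exists_of_tendsto hT (z := z) (g := p) hf (by simpa only [hu] using hp)
    exact ⟨_, hfe⟩
  have hrange : LinearMap.range (shift T z) = ⊤ := by
    have : IsClosed ((LinearMap.range (shift T z)) : Set H) := hclosed
    have : CompleteSpace (LinearMap.range (shift T z)) := this.completeSpace_coe
    rw [← Submodule.orthogonal_eq_bot_iff, Submodule.eq_bot_iff]
    intro y hy
    obtain ⟨hyd, hy0⟩ := mem_ker_of_inner_shift_eq_zero hT (z := z) (y := y) fun f => by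
      rw [real_inner_comm]
      exact (Submodule.mem_orthogonal _ _).1 hy _ (LinearMap.mem_range_self _ f)
    have := LinearMap.ker_eq_bot'.1 hker _ hy0
    exact congrArg Subtype.val this
  let e : T.domain ≃ₗ[ℝ] H := LinearEquiv.ofBijective (shift T z)
    ⟨LinearMap.ker_eq_bot.1 hker, LinearMap.range_eq_top.1 hrange⟩
  have he : ∀ f, e f = shift T z f := fun f => rfl
  let R : H →L[ℝ] H := (T.domain.subtype ∘ₗ e.symm.toLinearMap).mkContinuous c⁻¹ fun g => by
    have := h (e.symm g)
    rw [← he, e.apply_symm_apply] at this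
    rw [inv_mul_eq_div, le_div_iff₀ hc, mul_comm]
    exact this
  have hR : ∀ g, R g = (e.symm g : H) := fun g => rfl
  refine ⟨R, fun g => ?_, fun f => ?_⟩
  · refine ⟨by rw [hR]; exact (e.symm g).2, ?_⟩
    exact e.apply_symm_apply g
  · rw [hR]
    exact congrArg Subtype.val (e.symm_apply_apply f)

theorem exists_shift_lt_of_mem_spectrum (hT : IsSelfAdjoint T) {z : ℝ} (hz : z ∈ spectrum T)
    {ε : ℝ} (hε : 0 < ε) : ∃ f : T.domain, ‖shift T z f‖ < ε * ‖(f : H)‖ := by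
  by_contra! h
  exact hz (mem_resolventSet_of_bound hT hε h)

/-- The resolvent set is open: a lower bound survives small perturbations of `z`. -/
theorem exists_forall_mem_resolventSet (hT : IsSelfAdjoint T) {z : ℝ} (hz : z ∈ resolventSet T) :
    ∃ r > 0, ∀ w, |w - z| < r → w ∈ resolventSet T := by
  obtain ⟨c, hc, h⟩ := bound_of_mem_resolventSet hz
  refine ⟨c, hc, fun w hw => mem_resolventSet_of_bound hT (c := c - |w - z|) (by linarith) ?_⟩
  intro f
  have h1 : shift T z f = shift T w f + (w - z) • (f : H) := by
    rw [shift_apply, shift_apply, sub_smul]; abel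
  have h2 := h f
  have h3 := norm_add_le (shift T w f) ((w - z) • (f : H))
  rw [← h1, norm_smul, Real.norm_eq_abs] at h3
  linarith

theorem mem_spectrum_of_accPt (hT : IsSelfAdjoint T) {z : ℝ}
    (hz : AccPt z (𝓟 (spectrum T))) : z ∈ spectrum T := by
  intro h
  obtain ⟨r, hr, hw⟩ := exists_forall_mem_resolventSet hT h
  obtain ⟨y, hy, -⟩ := accPt_iff_nhds.1 hz _ (Metric.ball_mem_nhds z hr)
  exact hy.2 (hw y (by simpa [Real.dist_eq] using hy.1))

/-- The distance from `c` to the spectrum bounds `T - c` from below. -/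
theorem norm_le_shift_of_gap (hT : IsSelfAdjoint T) {c r : ℝ} (hr : 0 < r)
    (hgap : ∀ w, |w - c| < r → w ∈ resolventSet T) (f : T.domain) :
    r * ‖(f : H)‖ ≤ ‖shift T c f‖ := by
  obtain ⟨R, hR1, hR2⟩ := hgap c (by simpa using hr)
  have hsymm : ∀ g h : H, ⟪R g, h⟫ = ⟪g, R h⟫ := fun g h => by
    obtain ⟨hg, hg'⟩ := hR1 g
    obtain ⟨hh, hh'⟩ := hR1 h
    have := shift_symm hT c ⟨R g, hg⟩ ⟨R h, hh⟩
    rw [shift_apply, shift_apply] at this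
    simp only [hg', hh'] at this
    exact this.symm
  suffices hle : ‖R‖ ≤ r⁻¹ by
    have h1 : R (shift T c f) = f := hR2 f
    rw [← h1, ← le_inv_mul_iff₀ hr]
    exact (R.le_opNorm _).trans (by gcongr)
  by_contra! hlt
  -- the numbers `c ± ‖R‖⁻¹` lie in the gap, so that `R ∓ ‖R‖` are bounded from below
  set ρ := ‖R‖ with hρ
  have hρ0 : 0 < ρ := (inv_pos.2 hr).trans hlt
  have hs : ρ⁻¹ < r := inv_lt_of_inv_lt₀ hr hlt
  obtain ⟨κ, hκ, h1⟩ := resolvent_sub_bound (T := T) (c := c) (s := ρ⁻¹) (by positivity) hR1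
    (hgap _ (by rw [add_sub_cancel_left, abs_of_pos (by positivity)]; exact hs))
  obtain ⟨κ', hκ', h2⟩ := resolvent_sub_bound (T := T) (c := c) (s := -ρ⁻¹)
    (by rw [neg_ne_zero]; positivity) hR1
    (hgap _ (by rw [add_sub_cancel_left, abs_neg, abs_of_pos (by positivity)]; exact hs))
  -- `(R - ρ) (R + ρ) = R² - ρ²` and `‖(R² - ρ²) g‖² ≤ ρ² (ρ² ‖g‖² - ‖R g‖²)` then keep `‖R g‖` away
  -- from its supremum `ρ ‖g‖`
  have key : ∀ g : H, ‖R g‖ ^ 2 ≤ (ρ ^ 2 - (κ * κ' / ρ) ^ 2) * ‖g‖ ^ 2 := fun g => by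
    have e1 : R (R g - (-ρ⁻¹)⁻¹ • g) - (ρ⁻¹)⁻¹ • (R g - (-ρ⁻¹)⁻¹ • g)
        = R (R g) - (ρ ^ 2) • g := by
      rw [map_sub, map_smul, inv_neg, inv_inv, smul_sub, smul_smul, neg_smul, mul_neg, neg_smul, sq]
      abel
    have e2 : κ * κ' * ‖g‖ ≤ ‖R (R g) - (ρ ^ 2) • g‖ := by
      rw [← e1]
      refine le_trans ?_ (h1 _)
      rw [mul_assoc]
      exact mul_le_mul_of_nonneg_left (h2 g) hκ.le
    have e3 : ‖R (R g) - (ρ ^ 2) • g‖ ^ 2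
        = ‖R (R g)‖ ^ 2 - 2 * ρ ^ 2 * ‖R g‖ ^ 2 + ρ ^ 4 * ‖g‖ ^ 2 := by
      rw [norm_sub_sq_real, real_inner_smul_right, hsymm, real_inner_self_eq_norm_sq, norm_smul,
        Real.norm_eq_abs, mul_pow, sq_abs]
      ring
    have e4 : ‖R (R g)‖ ^ 2 ≤ ρ ^ 2 * ‖R g‖ ^ 2 := by
      rw [← mul_pow]
      exact pow_le_pow_left₀ (norm_nonneg _) (R.le_opNorm _) 2
    have e5 : (κ * κ' * ‖g‖) ^ 2 ≤ ‖R (R g) - (ρ ^ 2) • g‖ ^ 2 :=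
      pow_le_pow_left₀ (by positivity) e2 2
    have e6 : ρ ^ 2 * ‖R g‖ ^ 2 ≤ ρ ^ 2 * ((ρ ^ 2 - (κ * κ' / ρ) ^ 2) * ‖g‖ ^ 2) := by
      have : ρ ^ 2 * ((ρ ^ 2 - (κ * κ' / ρ) ^ 2) * ‖g‖ ^ 2)
          = ρ ^ 4 * ‖g‖ ^ 2 - (κ * κ' * ‖g‖) ^ 2 := by field_simp
      rw [this]
      nlinarith
    exact le_of_mul_le_mul_left e6 (by positivity)
  have hν : 0 < (κ * κ' / ρ) ^ 2 := by positivity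
  have hb : ρ ≤ √(ρ ^ 2 - (κ * κ' / ρ) ^ 2) := by
    refine R.opNorm_le_bound (Real.sqrt_nonneg _) fun g => ?_
    by_cases hg : ‖g‖ = 0
    · have := R.le_opNorm g
      rw [hg, mul_zero] at this ⊢
      exact this
    have hpos : 0 ≤ ρ ^ 2 - (κ * κ' / ρ) ^ 2 := by
      by_contra! hneg
      have : 0 < ‖g‖ ^ 2 := by positivity
      nlinarith [key g, sq_nonneg ‖R g‖]
    rw [← Real.sqrt_sq (norm_nonneg g), ← Real.sqrt_mul hpos, ← Real.sqrt_sq (norm_nonneg (R g))]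
    exact Real.sqrt_le_sqrt (key g)
  have : √(ρ ^ 2 - (κ * κ' / ρ) ^ 2) < √(ρ ^ 2) :=
    (Real.sqrt_lt_sqrt_iff_of_pos (by positivity)).2 (by linarith)
  rw [Real.sqrt_sq hρ0.le] at this
  linarith

end SelfAdjoint

/-! ### The bottom of the spectrum when it is not an accumulation point -/

section Gap

open Filter Topology
open scoped RealInnerProductSpace

variable {H : Type*} [NormedAddCommGroup H] [InnerProductSpace ℝ H] [CompleteSpace H]
variable {T : H →ₗ.[ℝ] H}

/-- Cauchy–Schwarz for the nonnegative form of `T - m`. -/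
theorem inner_shift_sq_le (hT : IsSelfAdjoint T) {m : ℝ}
    (hm : ∀ f : T.domain, 0 ≤ ⟪shift T m f, (f : H)⟫) (f g : T.domain) :
    ⟪shift T m f, (g : H)⟫ ^ 2 ≤ ⟪shift T m f, (f : H)⟫ * ⟪shift T m g, (g : H)⟫ := by
  have h : ∀ t : ℝ, 0 ≤ ⟪shift T m g, (g : H)⟫ * (t * t) + (2 * ⟪shift T m f, (g : H)⟫) * t
      + ⟪shift T m f, (f : H)⟫ := fun t => by
    have h1 := hm (f + t • g)
    have h2 : ⟪shift T m g, (f : H)⟫ = ⟪shift T m f, (g : H)⟫ := by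
      rw [shift_symm hT, real_inner_comm]
    rw [map_add, map_smul, Submodule.coe_add, Submodule.coe_smul, inner_add_left, inner_add_right,
      inner_add_right, real_inner_smul_left, real_inner_smul_left, real_inner_smul_right,
      real_inner_smul_right, h2] at h1
    linarith
  have := discrim_le_zero h
  rw [discrim] at this
  linarith

/-- If `(m, m + 2r)` is free of spectrum and `T ≥ m`, then `T - m ≥ 2r` on the range of `T - m`. -/
theorem le_inner_shift_of_range (hT : IsSelfAdjoint T) {m r : ℝ} (hr : 0 < r)
    (hm : ∀ f : T.domain, 0 ≤ ⟪shift T m f, (f : H)⟫)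
    (hgap : ∀ w, m < w → w < m + 2 * r → w ∈ resolventSet T) (u x : T.domain)
    (hx : shift T m u = x) :
    2 * r * ‖(x : H)‖ ^ 2 ≤ ⟪shift T m x, (x : H)⟫ := by
  -- the gap gives `(T - m)² ≥ 2r (T - m)`
  have hsq : 2 * r * ⟪shift T m u, (u : H)⟫ ≤ ‖(x : H)‖ ^ 2 := by
    have h1 := norm_le_shift_of_gap hT (c := m + r) hr
      (fun w hw => by rw [abs_lt] at hw; exact hgap w (by linarith) (by linarith)) u
    have h2 : shift T (m + r) u = (x : H) - r • (u : H) := by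
      rw [← hx, shift_apply, shift_apply, add_smul]; abel
    have h3 : (r * ‖(u : H)‖) ^ 2 ≤ ‖(x : H) - r • (u : H)‖ ^ 2 := by
      rw [← h2]; exact pow_le_pow_left₀ (by positivity) h1 2
    rw [norm_sub_sq_real, norm_smul, Real.norm_of_nonneg hr.le, real_inner_smul_right, ← hx] at h3
    rw [← hx]
    linarith
  have h4 : ⟪shift T m x, (u : H)⟫ = ‖(x : H)‖ ^ 2 := by
    rw [shift_symm hT, hx, real_inner_self_eq_norm_sq]
  have h5 := inner_shift_sq_le hT hm x u
  -- `‖x‖⁴ = ⟪(T - m) x, u⟫² ≤ ⟪(T - m) x, x⟫ ⟪(T - m) u, u⟫ ≤ ⟪(T - m) x, x⟫ ‖x‖² / 2r`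
  rw [h4] at h5
  rcases eq_or_ne (x : H) 0 with h0 | h0
  · simp [h0]
  · have hpos : 0 < ‖(x : H)‖ ^ 2 := by positivity
    refine le_of_mul_le_mul_right ?_ hpos
    nlinarith [hm x]

/-- If `T ≥ m` and `(m, m + 2r)` is free of spectrum, then a vector with small `T - m`-energy is
close to the kernel of `T - m`. The vector of the kernel is the limit of `η (T - m + η)⁻¹ f` as
`η → 0`. -/
theorem exists_ker_of_gap (hT : IsSelfAdjoint T) {m r : ℝ} (hr : 0 < r)
    (hm : ∀ f : T.domain, 0 ≤ ⟪shift T m f, (f : H)⟫)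
    (hgap : ∀ w, m < w → w < m + 2 * r → w ∈ resolventSet T) (f : T.domain) :
    ∃ v : T.domain, shift T m v = 0 ∧
      2 * r * ‖(f : H) - v‖ ^ 2 ≤ ⟪shift T m f, (f : H)⟫ := by
  have hres : ∀ η : ℝ, 0 < η → ∃ u : T.domain, shift T m u + η • (u : H) = f := fun η hη => by
    have hz : m - η ∈ resolventSet T := by
      refine mem_resolventSet_of_bound hT hη fun g => ?_
      have h1 : shift T (m - η) g = shift T m g + η • (g : H) := by
        rw [shift_apply, shift_apply, sub_smul]; abel
      have h2 : η * ‖(g : H)‖ ^ 2 ≤ ⟪shift T (m - η) g, (g : H)⟫ := by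
        rw [h1, inner_add_left, real_inner_smul_left, real_inner_self_eq_norm_sq]
        linarith [hm g]
      have h3 := real_inner_le_norm (shift T (m - η) g) (g : H)
      rcases eq_or_ne (g : H) 0 with h0 | h0
      · rw [h0, norm_zero, mul_zero]; exact norm_nonneg _
      · have : 0 < ‖(g : H)‖ := norm_pos_iff.2 h0
        refine le_of_mul_le_mul_right ?_ this
        nlinarith
    obtain ⟨R, hR, -⟩ := hz
    obtain ⟨hd, h⟩ := hR f
    refine ⟨⟨R f, hd⟩, ?_⟩
    rw [shift_apply]
    rw [sub_smul, sub_sub_eq_add_sub, add_sub_right_comm] at h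
    exact h
  choose! u hu using hres
  set η : ℕ → ℝ := fun n => 1 / ((n : ℝ) + 1) with hη
  have hη0 : ∀ n, 0 < η n := fun n => by positivity
  have hηt : Tendsto η atTop (𝓝 0) := tendsto_one_div_add_atTop_nhds_zero_nat
  set v : ℕ → T.domain := fun n => η n • u (η n) with hv
  set x : ℕ → T.domain := fun n => f - v n with hx
  have hxu : ∀ n, shift T m (u (η n)) = x n := fun n => by
    rw [hx]
    simp only [hv, Submodule.coe_sub, Submodule.coe_smul]
    rw [eq_sub_iff_add_eq, hu _ (hη0 n)]
  have hSv : ∀ n, shift T m (v n) = η n • (x n : H) := fun n => by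
    simp only [hv, map_smul, hxu]
  -- `f = x n + v n` with `⟪(T - m) (x n), v n⟫ ≥ 0`, so that `x n` has less energy than `f`
  have hxf : ∀ n, 2 * r * ‖(x n : H)‖ ^ 2 ≤ ⟪shift T m f, (f : H)⟫ := fun n => by
    refine (le_inner_shift_of_range hT hr hm hgap _ _ (hxu n)).trans ?_
    have hf : f = x n + v n := by simp [hx]
    have h1 : ⟪shift T m (x n), (v n : H)⟫ = η n * ‖(x n : H)‖ ^ 2 := by
      rw [shift_symm hT, hSv, real_inner_smul_right, real_inner_self_eq_norm_sq]
    have h2 : ⟪shift T m (v n), (x n : H)⟫ = η n * ‖(x n : H)‖ ^ 2 := by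
      rw [hSv, real_inner_smul_left, real_inner_self_eq_norm_sq]
    have h3 : ⟪shift T m f, (f : H)⟫ = ⟪shift T m (x n), (x n : H)⟫
        + 2 * (η n * ‖(x n : H)‖ ^ 2) + ⟪shift T m (v n), (v n : H)⟫ := by
      conv_lhs => rw [hf]
      rw [map_add, Submodule.coe_add, inner_add_left, inner_add_right, inner_add_right, h1, h2]
      ring
    have h4 : 0 ≤ η n * ‖(x n : H)‖ ^ 2 := mul_nonneg (hη0 n).le (sq_nonneg _)
    linarith [hm (v n)]
  obtain ⟨B, hB⟩ : ∃ B, ∀ n, ‖(x n : H)‖ ≤ B := by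
    refine ⟨√(⟪shift T m f, (f : H)⟫ / (2 * r)), fun n => Real.le_sqrt_of_sq_le ?_⟩
    rw [le_div_iff₀ (by positivity), mul_comm]
    exact hxf n
  -- `v n - v k` is in the range of `T - m`, where `T - m ≥ 2r`, and `(T - m) (v n) = η n • x n`
  have hcau : CauchySeq fun n => (v n : H) := by
    have hdist : ∀ n k, ‖(v n : H) - v k‖ ≤ (η n + η k) * (B / (2 * r)) := fun n k => by
      set y : T.domain := v n - v k with hy
      have h1 : shift T m (u (η k) - u (η n)) = y := by
        rw [map_sub, hxu, hxu, hy]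
        simp only [hx, Submodule.coe_sub]
        abel
      have h2 := le_inner_shift_of_range hT hr hm hgap _ _ h1
      have h3 := real_inner_le_norm (shift T m y) (y : H)
      have h4 : ‖shift T m y‖ ≤ (η n + η k) * B := by
        rw [hy, map_sub, hSv, hSv]
        refine (norm_sub_le _ _).trans ?_
        rw [norm_smul, norm_smul, Real.norm_of_nonneg (hη0 n).le, Real.norm_of_nonneg (hη0 k).le,
          add_mul]
        have := hη0 n
        have := hη0 k
        gcongr <;> exact hB _
      have h5 : 2 * r * ‖(y : H)‖ ≤ ‖shift T m y‖ := by
        rcases eq_or_ne (y : H) 0 with h0 | h0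
        · rw [h0, norm_zero, mul_zero]; exact norm_nonneg _
        · have : 0 < ‖(y : H)‖ := norm_pos_iff.2 h0
          refine le_of_mul_le_mul_right ?_ this
          nlinarith
      have h6 : ‖(y : H)‖ ≤ (η n + η k) * (B / (2 * r)) := by
        rw [← mul_div_assoc, le_div_iff₀ (by positivity)]
        linarith
      simpa [hy] using h6
    refine cauchySeq_of_le_tendsto_0 (fun N => (η N + η N) * (B / (2 * r))) ?_ ?_
    · intro n k N hn hk
      rw [dist_eq_norm]
      refine (hdist n k).trans ?_
      have hanti : ∀ i, N ≤ i → η i ≤ η N := fun i hi => by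
        simp only [hη]; gcongr
      have hB0 : 0 ≤ B := (norm_nonneg _).trans (hB 0)
      have h1 := hanti n hn
      have h2 := hanti k hk
      gcongr
    · simpa using (hηt.add hηt).mul_const (B / (2 * r))
  obtain ⟨w, hw⟩ := cauchySeq_tendsto_of_complete hcau
  have hSw : Tendsto (fun n => shift T m (v n)) atTop (𝓝 0) := by
    rw [tendsto_zero_iff_norm_tendsto_zero]
    refine squeeze_zero (fun n => norm_nonneg _) (fun n => ?_)
      (by simpa using hηt.mul_const B)
    rw [hSv, norm_smul, Real.norm_of_nonneg (hη0 n).le]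
    exact mul_le_mul_of_nonneg_left (hB n) (hη0 n).le
  obtain ⟨hwd, hw0⟩ := exists_of_tendsto hT hw hSw
  refine ⟨⟨w, hwd⟩, hw0, ?_⟩
  have hlim : Tendsto (fun n => 2 * r * ‖(f : H) - v n‖ ^ 2) atTop
      (𝓝 (2 * r * ‖(f : H) - w‖ ^ 2)) :=
    ((hw.const_sub (f : H)).norm.pow 2).const_mul _
  exact le_of_tendsto' hlim fun n => by simpa [hx] using hxf n

/-- Suppose that `T ≥ m`, that eigenvectors for `m` are determined by the value of a functional `ℓ`,
and that there are vectors in the kernel of `ℓ` whose energy is almost `m`. Then `m` is in the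
essential spectrum: a gap above `m` would put these vectors close to an eigenspace of
dimension at most one, on which `ℓ` controls the norm. -/
theorem mem_essSpectrum_of_energy (hT : IsSelfAdjoint T) {m : ℝ}
    (hm : ∀ f : T.domain, 0 ≤ ⟪shift T m f, (f : H)⟫) (ℓ : H →L[ℝ] ℝ)
    (hℓ : ∀ v : T.domain, shift T m v = 0 → ℓ v = 0 → v = 0)
    (htest : ∀ δ > 0, ∃ f : T.domain, (f : H) ≠ 0 ∧ ℓ f = 0 ∧
      ⟪shift T m f, (f : H)⟫ ≤ δ * ‖(f : H)‖ ^ 2) :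
    m ∈ essSpectrum T := by
  have hacc : AccPt m (𝓟 (spectrum T)) := by
    rw [accPt_iff_nhds]
    by_contra! hcon
    obtain ⟨U, hU, hUs⟩ := hcon
    obtain ⟨ε, hε, hball⟩ := Metric.mem_nhds_iff.1 hU
    have hgap : ∀ w, m < w → w < m + 2 * (ε / 2) → w ∈ resolventSet T := fun w h1 h2 => by
      by_contra hw
      have : w = m := hUs w ⟨hball (by
        rw [Metric.mem_ball, Real.dist_eq, abs_of_pos (by linarith)]; linarith), hw⟩
      linarith
    obtain ⟨C, hC0, hC⟩ : ∃ C > 0, ∀ v : T.domain, shift T m v = 0 → ‖(v : H)‖ ≤ C * ‖ℓ v‖ := by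
      by_cases hex : ∃ v₀ : T.domain, shift T m v₀ = 0 ∧ v₀ ≠ 0
      · obtain ⟨v₀, h0, hne⟩ := hex
        have hℓ0 : ℓ v₀ ≠ 0 := fun h => hne (hℓ v₀ h0 h)
        have hn0 : 0 < ‖(v₀ : H)‖ := norm_pos_iff.2 fun h => hne (Subtype.ext h)
        refine ⟨‖(v₀ : H)‖ / ‖ℓ v₀‖, div_pos hn0 (norm_pos_iff.2 hℓ0), fun v hv => ?_⟩
        have h1 : v - (ℓ v / ℓ v₀) • v₀ = 0 := by
          refine hℓ _ ?_ ?_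
          · rw [map_sub, map_smul, hv, h0, smul_zero, sub_zero]
          · rw [Submodule.coe_sub, Submodule.coe_smul, map_sub, map_smul, smul_eq_mul,
              div_mul_cancel₀ _ hℓ0, sub_self]
        rw [sub_eq_zero.1 h1]
        rw [Submodule.coe_smul, norm_smul, map_smul, smul_eq_mul, norm_mul, norm_div]
        have : 0 < ‖ℓ v₀‖ := norm_pos_iff.2 hℓ0
        apply le_of_eq
        field_simp
      · push Not at hex
        refine ⟨1, one_pos, fun v hv => ?_⟩
        rw [hex v hv]
        simp
    -- with `D = 1 + C ‖ℓ‖`, the vector `v` of the kernel near `f` satisfies `‖f‖ ≤ D ‖f - v‖`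
    set D := 1 + C * ‖ℓ‖ with hD
    have hD0 : 0 < D := by positivity
    obtain ⟨f, hf0, hℓf, hfE⟩ := htest (ε / (2 * D ^ 2)) (by positivity)
    obtain ⟨v, hv, hvf⟩ := exists_ker_of_gap hT (half_pos hε) hm hgap f
    have h1 : ‖(f : H)‖ ≤ D * ‖(f : H) - v‖ := by
      have h2 : ‖ℓ v‖ ≤ ‖ℓ‖ * ‖(f : H) - v‖ := by
        have := ℓ.le_opNorm ((f : H) - v)
        rwa [map_sub, hℓf, zero_sub, norm_neg] at this
      have h3 : ‖(f : H)‖ ≤ ‖(f : H) - v‖ + ‖(v : H)‖ := by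
        simpa using norm_add_le ((f : H) - v) v
      have h4 := hC v hv
      have h5 := mul_le_mul_of_nonneg_left h2 hC0.le
      rw [hD]
      linarith
    have h2 : ‖(f : H)‖ ^ 2 ≤ D ^ 2 * ‖(f : H) - v‖ ^ 2 := by
      rw [← mul_pow]; exact pow_le_pow_left₀ (norm_nonneg _) h1 2
    have h3 : 0 < ‖(f : H)‖ ^ 2 := by
      have := norm_pos_iff.2 hf0
      positivity
    have h4 : D ^ 2 * (ε / (2 * D ^ 2) * ‖(f : H)‖ ^ 2) = ε / 2 * ‖(f : H)‖ ^ 2 := by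
      field_simp
    have h5 := mul_le_mul_of_nonneg_left (hvf.trans hfE) (sq_nonneg D)
    rw [h4] at h5
    have h6 := mul_le_mul_of_nonneg_left h2 hε.le
    nlinarith
  exact ⟨mem_spectrum_of_accPt hT hacc, Or.inl hacc⟩

/-- The spectrum lies above every lower bound of the form. -/
theorem le_of_mem_spectrum (hT : IsSelfAdjoint T) {m : ℝ}
    (hm : ∀ f : T.domain, 0 ≤ ⟪shift T m f, (f : H)⟫) {z : ℝ} (hz : z ∈ spectrum T) : m ≤ z := by
  by_contra! hlt
  obtain ⟨g, hg⟩ := exists_shift_lt_of_mem_spectrum hT hz (sub_pos.2 hlt)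
  have h1 : shift T z g = shift T m g + (m - z) • (g : H) := by
    rw [shift_apply, shift_apply, sub_smul]; abel
  have h2 : (m - z) * ‖(g : H)‖ ^ 2 ≤ ⟪shift T z g, (g : H)⟫ := by
    rw [h1, inner_add_left, real_inner_smul_left, real_inner_self_eq_norm_sq]
    linarith [hm g]
  have h3 := real_inner_le_norm (shift T z g) (g : H)
  have h0 : 0 < ‖(g : H)‖ := by
    rcases (norm_nonneg (g : H)).eq_or_lt' with h | h
    · rw [h, mul_zero] at hg
      exact absurd hg (norm_nonneg _).not_gt
    · exact h
  nlinarith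

end Gap

/-! ### Green's formula and self-adjointness of the birth-death operator -/

section Green

open Filter Topology
open scoped RealInnerProductSpace

/-- The flux `a_n (f n - f (n + 1))` through the edge `{n, n + 1}`. -/
noncomputable def flux (α : ℝ) (f : ℕ → ℝ) (n : ℕ) : ℝ := edgeWeight α n * (f n - f (n + 1))

theorem one_le_logPlus (x : ℝ) : 1 ≤ logPlus x := le_max_right _ _

theorem logPlus_pos (x : ℝ) : 0 < logPlus x := one_pos.trans_le (one_le_logPlus x)

theorem edgeWeight_pos (α : ℝ) (n : ℕ) : 0 < edgeWeight α n := by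
  have := Real.rpow_pos_of_pos (logPlus_pos ((n : ℝ) + 1)) α
  rw [edgeWeight]
  positivity

theorem laplacian_zero (α : ℝ) (f : ℕ → ℝ) :
    laplacian lineGraph (weight α) f 0 = -flux α f 0 := by
  have h : lineGraph.neighborFinset 0 = {1} := by
    ext m
    simp only [SimpleGraph.mem_neighborFinset, Finset.mem_singleton]
    change (m = 0 + 1 ∨ 0 = m + 1) ↔ _
    omega
  change ∑ y ∈ lineGraph.neighborFinset 0, weight α 0 y * (f y - f 0) = _
  rw [h, Finset.sum_singleton, weight, if_pos rfl, flux]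
  ring

theorem laplacian_succ (α : ℝ) (f : ℕ → ℝ) (n : ℕ) :
    laplacian lineGraph (weight α) f (n + 1) = flux α f n - flux α f (n + 1) := by
  have h : lineGraph.neighborFinset (n + 1) = {n, n + 2} := by
    ext m
    simp only [SimpleGraph.mem_neighborFinset, Finset.mem_singleton, Finset.mem_insert]
    change (m = n + 1 + 1 ∨ n + 1 = m + 1) ↔ _
    omega
  change ∑ y ∈ lineGraph.neighborFinset (n + 1), weight α (n + 1) y * (f y - f (n + 1)) = _
  rw [h, Finset.sum_pair (by omega), weight, if_neg (by omega), if_pos rfl, weight, if_pos rfl,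
    flux, flux]
  ring

theorem sum_laplacian (α : ℝ) (f : ℕ → ℝ) (N : ℕ) :
    ∑ n ∈ Finset.range (N + 1), -laplacian lineGraph (weight α) f n = flux α f N := by
  induction N with
  | zero => simp [laplacian_zero]
  | succ N ih => rw [Finset.sum_range_succ, ih, laplacian_succ]; ring

/-- Green's formula on `{0, …, N}`. -/
theorem sum_laplacian_mul (α : ℝ) (f g : ℕ → ℝ) (N : ℕ) :
    ∑ n ∈ Finset.range (N + 1), -laplacian lineGraph (weight α) f n * g n =
      ∑ n ∈ Finset.range N, edgeWeight α n * ((f n - f (n + 1)) * (g n - g (n + 1)))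
        + flux α f N * g N := by
  induction N with
  | zero => simp [laplacian_zero]
  | succ N ih =>
    rw [Finset.sum_range_succ, ih, laplacian_succ, Finset.sum_range_succ]
    simp only [flux]
    ring

variable {α : ℝ}

theorem birthDeath_apply (f : (birthDeath α).domain) (n : ℕ) :
    (birthDeath α f : ℕ → ℝ) n
      = -laplacian lineGraph (weight α) ((f : lp (fun _ : ℕ => ℝ) 2) : ℕ → ℝ) n := rfl

theorem mem_domain_iff (f : lp (fun _ : ℕ => ℝ) 2) : f ∈ (birthDeath α).domain ↔
    Memℓp (laplacian lineGraph (weight α) (f : ℕ → ℝ)) 2 := Iff.rfl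

theorem hasSum_mul (f g : lp (fun _ : ℕ => ℝ) 2) : HasSum (fun n => f n * g n) ⟪f, g⟫ := by
  simpa [mul_comm] using lp.hasSum_inner (𝕜 := ℝ) f g

theorem hasSum_sq (f : lp (fun _ : ℕ => ℝ) 2) : HasSum (fun n => f n ^ 2) (‖f‖ ^ 2) := by
  rw [← real_inner_self_eq_norm_sq]
  simpa only [sq] using hasSum_mul f f

theorem memℓp_of_forall_ge {h : ℕ → ℝ} {K : ℕ} (hK : ∀ n, K ≤ n → h n = 0) :
    Memℓp h 2 := by
  refine memℓp_gen (summable_of_ne_finset_zero (s := Finset.range K) fun n hn => ?_)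
  rw [hK n (by simpa using hn)]
  simp

theorem mem_domain_of_forall_ge {f : lp (fun _ : ℕ => ℝ) 2} {K : ℕ}
    (hK : ∀ n, K ≤ n → f n = 0) : f ∈ (birthDeath α).domain := by
  refine memℓp_of_forall_ge (K := K + 1) fun n hn => ?_
  obtain ⟨n, rfl⟩ : ∃ k, n = k + 1 := ⟨n - 1, by omega⟩
  rw [laplacian_succ, flux, flux, hK n (by omega), hK (n + 1) (by omega),
    hK (n + 1 + 1) (by omega)]
  ring

/-- A summable sequence `h` has `(N + 1) h_N` small along a subsequence, since the harmonic series
diverges. -/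
theorem frequently_mul_lt {h : ℕ → ℝ} (hs : Summable h) {ε : ℝ} (hε : 0 < ε) :
    ∃ᶠ N : ℕ in atTop, ((N : ℝ) + 1) * h N < ε := by
  intro hcon
  obtain ⟨M, hM⟩ := eventually_atTop.1 hcon
  have h1 : Summable fun n : ℕ => (1 : ℝ) / ((n + M : ℕ) + 1) := by
    refine Summable.of_nonneg_of_le (fun n => by positivity) (fun n => ?_)
      (((summable_nat_add_iff M).2 hs).mul_left ε⁻¹)
    have := not_lt.1 (hM (n + M) (by omega))
    rw [div_le_iff₀ (by positivity), inv_mul_eq_div, div_mul_eq_mul_div, le_div_iff₀ hε]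
    linarith
  have h2 := (summable_nat_add_iff (f := fun n : ℕ => (1 : ℝ) / ((n : ℝ) + 1)) M).1 h1
  exact Real.not_summable_one_div_natCast
    ((summable_nat_add_iff 1).1 (by simpa using h2))

/-- A bound with a boundary term `u M` passes to the limit if `u` is small along a subsequence. -/
theorem le_of_frequently {s u : ℕ → ℝ} {A S : ℝ} (hs : Tendsto s atTop (𝓝 S))
    (hA : ∀ᶠ M in atTop, A ≤ s M + u M) (hu : ∀ ε > 0, ∃ᶠ M in atTop, u M < ε) : A ≤ S := by
  by_contra! hlt
  obtain ⟨M, hM1, hM2, hM3⟩ := ((hu ((A - S) / 2) (by linarith)).and_eventually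
    (hA.and (hs.eventually_lt_const (show S < (A + S) / 2 by linarith)))).exists
  linarith

/-- Cauchy–Schwarz for `flux N = ∑ n ≤ N, (T f) n`. -/
theorem flux_sq_le (f : (birthDeath α).domain) (N : ℕ) :
    flux α ((f : lp (fun _ : ℕ => ℝ) 2) : ℕ → ℝ) N ^ 2 ≤ ((N : ℝ) + 1) * ‖birthDeath α f‖ ^ 2 := by
  rw [← sum_laplacian]
  refine sq_sum_le_card_mul_sum_sq.trans ?_
  rw [Finset.card_range]
  push_cast
  refine mul_le_mul_of_nonneg_left ?_ (by positivity)
  exact sum_le_hasSum _ (fun n _ => sq_nonneg _) (hasSum_sq (birthDeath α f))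

theorem inner_birthDeath_le (f g : (birthDeath α).domain) :
    ⟪birthDeath α f, (g : lp (fun _ : ℕ => ℝ) 2)⟫
      ≤ ⟪(f : lp (fun _ : ℕ => ℝ) 2), birthDeath α g⟫ := by
  set F : ℕ → ℝ := ((f : lp (fun _ : ℕ => ℝ) 2) : ℕ → ℝ) with hF
  set G : ℕ → ℝ := ((g : lp (fun _ : ℕ => ℝ) 2) : ℕ → ℝ) with hG
  have hs1 := (tendsto_add_atTop_iff_nat 1).2 (hasSum_mul (birthDeath α f) g).tendsto_sum_nat
  have hs2 := (tendsto_add_atTop_iff_nat 1).2 (hasSum_mul (birthDeath α g) f).tendsto_sum_nat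
  rw [real_inner_comm (birthDeath α g), ← sub_nonpos]
  have hdiff := hs1.sub hs2
  set L := ⟪birthDeath α f, (g : lp (fun _ : ℕ => ℝ) 2)⟫
    - ⟪birthDeath α g, (f : lp (fun _ : ℕ => ℝ) 2)⟫ with hL
  have hW : ∀ N, (∑ n ∈ Finset.range (N + 1), (birthDeath α f : ℕ → ℝ) n * G n
      - ∑ n ∈ Finset.range (N + 1), (birthDeath α g : ℕ → ℝ) n * F n)
      = flux α F N * G N - flux α G N * F N := fun N => by
    have e1 := sum_laplacian_mul α F G N
    have e2 := sum_laplacian_mul α G F N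
    simp only [birthDeath_apply]
    rw [e1, e2]
    have : ∀ n, (F n - F (n + 1)) * (G n - G (n + 1)) = (G n - G (n + 1)) * (F n - F (n + 1)) :=
      fun n => mul_comm _ _
    simp only [this]
    ring
  refine le_of_frequently (s := fun N => L - (∑ n ∈ Finset.range (N + 1),
    (birthDeath α f : ℕ → ℝ) n * G n
      - ∑ n ∈ Finset.range (N + 1), (birthDeath α g : ℕ → ℝ) n * F n))
    (u := fun N => flux α F N * G N - flux α G N * F N) ?_ ?_ ?_
  · simpa using hdiff.const_sub L
  · exact Eventually.of_forall fun N => by rw [hW]; linarith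
  · intro ε hε
    set B := ‖birthDeath α f‖ ^ 2 + ‖birthDeath α g‖ ^ 2 + 1 with hB
    have hB0 : 0 < B := by positivity
    refine (frequently_mul_lt ((hasSum_sq (f : lp (fun _ : ℕ => ℝ) 2)).add
      (hasSum_sq (g : lp (fun _ : ℕ => ℝ) 2))).summable
      (show 0 < ε ^ 2 / (2 * B) by positivity)).mono fun N hN => ?_
    rw [lt_div_iff₀ (by positivity)] at hN
    refine lt_of_pow_lt_pow_left₀ 2 hε.le (lt_of_le_of_lt ?_ hN)
    have e1 := flux_sq_le f N
    have e2 := flux_sq_le g N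
    rw [← hF] at e1
    rw [← hG] at e2
    have hN1 : (0 : ℝ) < (N : ℝ) + 1 := by positivity
    have e3 : flux α F N ^ 2 * G N ^ 2 ≤ ((N : ℝ) + 1) * B * G N ^ 2 := by
      refine mul_le_mul_of_nonneg_right (e1.trans ?_) (sq_nonneg _)
      refine mul_le_mul_of_nonneg_left ?_ hN1.le
      rw [hB]; nlinarith [sq_nonneg ‖birthDeath α g‖]
    have e4 : flux α G N ^ 2 * F N ^ 2 ≤ ((N : ℝ) + 1) * B * F N ^ 2 := by
      refine mul_le_mul_of_nonneg_right (e2.trans ?_) (sq_nonneg _)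
      refine mul_le_mul_of_nonneg_left ?_ hN1.le
      rw [hB]; nlinarith [sq_nonneg ‖birthDeath α f‖]
    change (flux α F N * G N - flux α G N * F N) ^ 2 ≤ ((N : ℝ) + 1) * (F N ^ 2 + G N ^ 2) * (2 * B)
    nlinarith [sq_nonneg (flux α F N * G N + flux α G N * F N)]

theorem birthDeath_symm (f g : (birthDeath α).domain) :
    ⟪birthDeath α f, (g : lp (fun _ : ℕ => ℝ) 2)⟫
      = ⟪(f : lp (fun _ : ℕ => ℝ) 2), birthDeath α g⟫ := by
  refine (inner_birthDeath_le f g).antisymm ?_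
  rw [real_inner_comm, real_inner_comm _ (birthDeath α f)]
  exact inner_birthDeath_le g f

/-- Green's formula for an arbitrary sequence against a finitely supported one. -/
theorem inner_birthDeath_of_forall_ge (y : lp (fun _ : ℕ => ℝ) 2) (g : (birthDeath α).domain)
    {K : ℕ} (hK : ∀ n, K ≤ n → (g : lp (fun _ : ℕ => ℝ) 2) n = 0) :
    ⟪birthDeath α g, y⟫ = ∑ n ∈ Finset.range (K + 1),
      -laplacian lineGraph (weight α) (y : ℕ → ℝ) n * (g : lp (fun _ : ℕ => ℝ) 2) n := by
  have hfin : ∀ n ∉ Finset.range (K + 1), (birthDeath α g : ℕ → ℝ) n * y n = 0 := fun n hn => by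
    simp only [Finset.mem_range, not_lt] at hn
    obtain ⟨n, rfl⟩ : ∃ k, n = k + 1 := ⟨n - 1, by omega⟩
    rw [birthDeath_apply, laplacian_succ, flux, flux, hK n (by omega), hK (n + 1) (by omega),
      hK (n + 1 + 1) (by omega)]
    ring
  rw [(hasSum_mul (birthDeath α g) y).unique (hasSum_sum_of_ne_finset_zero hfin)]
  simp only [birthDeath_apply]
  rw [sum_laplacian_mul, sum_laplacian_mul, flux, flux, hK K le_rfl, hK (K + 1) (by omega)]
  simp only [sub_zero, mul_zero, zero_mul, add_zero]
  exact Finset.sum_congr rfl fun n _ => by ring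

theorem single_mem_domain (n : ℕ) : lp.single 2 n (1 : ℝ) ∈ (birthDeath α).domain :=
  mem_domain_of_forall_ge (K := n + 1) fun k hk => by
    rw [lp.single_apply_ne _ _ _ (by omega)]

theorem dense_domain (α : ℝ) : Dense ((birthDeath α).domain : Set (lp (fun _ : ℕ => ℝ) 2)) := by
  rw [Submodule.dense_iff_topologicalClosure_eq_top, Submodule.topologicalClosure_eq_top_iff,
    Submodule.eq_bot_iff]
  intro y hy
  ext n
  have h := (Submodule.mem_orthogonal _ _).1 hy _ (single_mem_domain (α := α) n)
  rw [lp.inner_single_left] at h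
  simpa using h

/-- The maximal operator is self-adjoint: Green's formula has no boundary term at infinity,
because `|flux N| ≤ √(N + 1) ‖T f‖` while `√(N + 1) |g N|` is small along a subsequence. -/
theorem isSelfAdjoint_birthDeath (α : ℝ) : IsSelfAdjoint (birthDeath α) := by
  rw [LinearPMap.isSelfAdjoint_def]
  have hd := dense_domain α
  have hle : birthDeath α ≤ (birthDeath α).adjoint :=
    LinearPMap.IsFormalAdjoint.le_adjoint hd fun f g => birthDeath_symm f g
  refine le_antisymm ?_ hle
  have key : ∀ y : (birthDeath α).adjoint.domain,
      (y : lp (fun _ : ℕ => ℝ) 2) ∈ (birthDeath α).domain := by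
    intro y
    -- test the adjoint against the unit vectors
    have hy : ∀ n, ((birthDeath α).adjoint y : ℕ → ℝ) n
        = -laplacian lineGraph (weight α) ((y : lp (fun _ : ℕ => ℝ) 2) : ℕ → ℝ) n := fun n => by
      have h1 := LinearPMap.adjoint_isFormalAdjoint (T := birthDeath α) hd y
        ⟨lp.single 2 n (1 : ℝ), single_mem_domain n⟩
      have h2 := inner_birthDeath_of_forall_ge (α := α) (y : lp (fun _ : ℕ => ℝ) 2)
        ⟨lp.single 2 n (1 : ℝ), single_mem_domain n⟩ (K := n + 1) fun k hk => by
          exact lp.single_apply_ne (E := fun _ : ℕ => ℝ) 2 n (1 : ℝ) (by omega)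
      rw [real_inner_comm, ← h1, lp.inner_single_right, Finset.sum_eq_single n] at h2
      · simpa using h2
      · intro k _ hk
        rw [lp.single_apply_ne (E := fun _ : ℕ => ℝ) 2 n (1 : ℝ) hk, mul_zero]
      · intro hn
        exact absurd (Finset.mem_range.2 (by omega)) hn
    rw [mem_domain_iff]
    have h := (lp.memℓp ((birthDeath α).adjoint y)).neg
    convert h using 1
    funext n
    simp [hy n]
  refine ⟨fun y hy => key ⟨y, hy⟩, fun x y hxy => ?_⟩
  rw [hle.2 hxy.symm]

end Green

/-! ### Hardy's inequality and lower bounds for the form -/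

section Hardy

open Filter Topology
open scoped RealInnerProductSpace

/-- Hardy's inequality on `{N, …, M - 1}`, with its boundary terms. The step of the induction is
`2 (t (x - y) - (x + y) / 4) ^ 2 + (x - y) ^ 2 / 8 ≥ 0` with `t = M + 1`. -/
theorem hardy_Ico (f : ℕ → ℝ) {N M : ℕ} (h : N ≤ M) :
    (1 / 2) * ∑ n ∈ Finset.Ico N M, f n ^ 2 + ((N : ℝ) + 1 / 4) * f N ^ 2 ≤
      2 * ∑ n ∈ Finset.Ico N M, ((n : ℝ) + 1) ^ 2 * (f n - f (n + 1)) ^ 2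
        + ((M : ℝ) + 1 / 4) * f M ^ 2 := by
  induction M, h using Nat.le_induction with
  | base => simp
  | succ M hM ih =>
    rw [Finset.sum_Ico_succ_top hM, Finset.sum_Ico_succ_top hM]
    push_cast
    nlinarith [sq_nonneg (((M : ℝ) + 1) * (f M - f (M + 1)) - (f M + f (M + 1)) / 4),
      sq_nonneg (f M - f (M + 1))]

theorem hardy_Ico' (f : ℕ → ℝ) {N M : ℕ} (h : N ≤ M) :
    ∑ n ∈ Finset.Ico N M, f n ^ 2 ≤
      4 * ∑ n ∈ Finset.Ico N M, ((n : ℝ) + 1) ^ 2 * (f n - f (n + 1)) ^ 2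
        + 2 * (((M : ℝ) + 1) * f M ^ 2) := by
  have h1 := hardy_Ico f h
  have h2 : 0 ≤ ((N : ℝ) + 1 / 4) * f N ^ 2 := by positivity
  nlinarith [sq_nonneg (f M)]

theorem hardy_finsupp (f : ℕ →₀ ℝ) :
    (1 / 9 : ℝ) * ∑' n : ℕ, f n ^ 2 ≤ ∑' n : ℕ, ((n : ℝ) + 1) ^ 2 * (f n - f (n + 1)) ^ 2 := by
  obtain ⟨K, hK⟩ : ∃ K, ∀ n, K ≤ n → f n = 0 := by
    refine ⟨f.support.sup id + 1, fun n hn => ?_⟩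
    by_contra h0
    have := Finset.le_sup (f := id) (Finsupp.mem_support_iff.2 h0)
    simp only [id] at this
    omega
  rw [tsum_eq_sum (s := Finset.Ico 0 K) fun n hn => ?_,
    tsum_eq_sum (s := Finset.Ico 0 K) fun n hn => ?_]
  · have h := hardy_Ico' f (Nat.zero_le K)
    rw [hK K le_rfl] at h
    have : 0 ≤ ∑ n ∈ Finset.Ico 0 K, f n ^ 2 := Finset.sum_nonneg fun n _ => sq_nonneg _
    linarith
  all_goals
    simp only [Finset.mem_Ico, Nat.zero_le, true_and, not_lt] at hn
    simp [hK n hn, hK (n + 1) (by omega)]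

variable {α : ℝ}

/-- The energy of `f` is at most `⟪T f, f⟫`. -/
theorem sum_energy_le (f : (birthDeath α).domain) (N : ℕ) :
    ∑ n ∈ Finset.range N, edgeWeight α n * ((f : lp (fun _ : ℕ => ℝ) 2) n
        - (f : lp (fun _ : ℕ => ℝ) 2) (n + 1)) ^ 2
      ≤ ⟪birthDeath α f, (f : lp (fun _ : ℕ => ℝ) 2)⟫ := by
  set F : ℕ → ℝ := ((f : lp (fun _ : ℕ => ℝ) 2) : ℕ → ℝ) with hF
  have hs := (tendsto_add_atTop_iff_nat 1).2 (hasSum_mul (birthDeath α f) f).tendsto_sum_nat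
  refine le_of_frequently (u := fun M => -(flux α F M * F M)) hs ?_ ?_
  · filter_upwards [eventually_ge_atTop N] with M hM
    simp only [birthDeath_apply]
    rw [sum_laplacian_mul, add_neg_cancel_right]
    simp only [← sq]
    exact Finset.sum_le_sum_of_subset_of_nonneg (Finset.range_mono hM) fun n _ _ =>
      mul_nonneg (edgeWeight_pos α n).le (sq_nonneg _)
  · intro ε hε
    refine (frequently_mul_lt (hasSum_sq (f : lp (fun _ : ℕ => ℝ) 2)).summable
      (show 0 < ε ^ 2 / (‖birthDeath α f‖ ^ 2 + 1) by positivity)).mono fun M hM => ?_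
    rw [lt_div_iff₀ (by positivity)] at hM
    refine lt_of_pow_lt_pow_left₀ 2 hε.le (lt_of_le_of_lt ?_ hM)
    have h1 := mul_le_mul_of_nonneg_right (flux_sq_le f M) (sq_nonneg (F M))
    have h2 : 0 ≤ ((M : ℝ) + 1) * F M ^ 2 := by positivity
    change (-(flux α F M * F M)) ^ 2 ≤ ((M : ℝ) + 1) * F M ^ 2 * (‖birthDeath α f‖ ^ 2 + 1)
    rw [neg_sq, mul_pow]
    linarith

theorem inner_birthDeath_nonneg (f : (birthDeath α).domain) :
    0 ≤ ⟪birthDeath α f, (f : lp (fun _ : ℕ => ℝ) 2)⟫ := by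
  simpa using sum_energy_le f 0

theorem logPlus_mono {x y : ℝ} (hx : 0 < x) (h : x ≤ y) : logPlus x ≤ logPlus y :=
  max_le_max_right _ (Real.log_le_log hx h)

/-- For `α ≥ 0` the form controls the tails of `f`, by Hardy's inequality beyond `N`. -/
theorem sum_Ico_sq_le (hα : 0 ≤ α) (f : (birthDeath α).domain) {N M : ℕ} (hNM : N ≤ M) :
    ∑ n ∈ Finset.Ico N M, (f : lp (fun _ : ℕ => ℝ) 2) n ^ 2
      ≤ 4 / logPlus ((N : ℝ) + 1) ^ α * ⟪birthDeath α f, (f : lp (fun _ : ℕ => ℝ) 2)⟫ := by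
  set F : ℕ → ℝ := ((f : lp (fun _ : ℕ => ℝ) 2) : ℕ → ℝ) with hF
  set c := logPlus ((N : ℝ) + 1) ^ α with hc
  have hc0 : 0 < c := Real.rpow_pos_of_pos (logPlus_pos _) _
  refine le_of_frequently (u := fun K => 2 * (((K : ℝ) + 1) * F K ^ 2)) tendsto_const_nhds ?_ ?_
  · filter_upwards [eventually_ge_atTop M] with K hK
    have h1 : ∑ n ∈ Finset.Ico N M, F n ^ 2 ≤ ∑ n ∈ Finset.Ico N K, F n ^ 2 :=
      Finset.sum_le_sum_of_subset_of_nonneg (Finset.Ico_subset_Ico_right hK)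
        fun n _ _ => sq_nonneg _
    have h2 := hardy_Ico' F (hNM.trans hK)
    have h3 : c * ∑ n ∈ Finset.Ico N K, ((n : ℝ) + 1) ^ 2 * (F n - F (n + 1)) ^ 2
        ≤ ⟪birthDeath α f, (f : lp (fun _ : ℕ => ℝ) 2)⟫ := by
      refine le_trans ?_ (sum_energy_le f K)
      rw [Finset.mul_sum]
      refine le_trans (Finset.sum_le_sum fun n hn => ?_)
        (Finset.sum_le_sum_of_subset_of_nonneg
          (f := fun n => edgeWeight α n * (F n - F (n + 1)) ^ 2)
          (fun _ hn => Finset.mem_range.2 (Finset.mem_Ico.1 hn).2)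
          fun n _ _ => mul_nonneg (edgeWeight_pos α n).le (sq_nonneg _))
      rw [← mul_assoc, edgeWeight, mul_comm c]
      have hNn : (N : ℝ) + 1 ≤ (n : ℝ) + 1 := by
        have : (N : ℝ) ≤ n := by exact_mod_cast (Finset.mem_Ico.1 hn).1
        linarith
      have h4 : c ≤ logPlus ((n : ℝ) + 1) ^ α :=
        Real.rpow_le_rpow (logPlus_pos _).le (logPlus_mono (by positivity) hNn) hα
      gcongr
    have h5 : ∑ n ∈ Finset.Ico N K, ((n : ℝ) + 1) ^ 2 * (F n - F (n + 1)) ^ 2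
        ≤ ⟪birthDeath α f, (f : lp (fun _ : ℕ => ℝ) 2)⟫ / c := by
      rw [le_div_iff₀ hc0, mul_comm]; exact h3
    have h6 : 4 / c * ⟪birthDeath α f, (f : lp (fun _ : ℕ => ℝ) 2)⟫
        = 4 * (⟪birthDeath α f, (f : lp (fun _ : ℕ => ℝ) 2)⟫ / c) := by ring
    rw [h6]
    linarith
  · intro ε hε
    refine (frequently_mul_lt (hasSum_sq (f : lp (fun _ : ℕ => ℝ) 2)).summable
      (half_pos hε)).mono fun K hK => ?_
    linarith

theorem norm_sq_le (hα : 0 ≤ α) (f : (birthDeath α).domain) (N : ℕ) :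
    ‖(f : lp (fun _ : ℕ => ℝ) 2)‖ ^ 2
      ≤ ∑ n ∈ Finset.range N, (f : lp (fun _ : ℕ => ℝ) 2) n ^ 2
        + 4 / logPlus ((N : ℝ) + 1) ^ α * ⟪birthDeath α f, (f : lp (fun _ : ℕ => ℝ) 2)⟫ := by
  refine le_of_tendsto (hasSum_sq (f : lp (fun _ : ℕ => ℝ) 2)).tendsto_sum_nat ?_
  filter_upwards [eventually_ge_atTop N] with M hM
  rw [← Finset.sum_range_add_sum_Ico _ hM]
  exact add_le_add_right (sum_Ico_sq_le hα f hM) _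

theorem norm_sq_le_four_mul (f : (birthDeath 0).domain) :
    ‖(f : lp (fun _ : ℕ => ℝ) 2)‖ ^ 2
      ≤ 4 * ⟪birthDeath 0 f, (f : lp (fun _ : ℕ => ℝ) 2)⟫ := by
  simpa using norm_sq_le le_rfl f 0

/-- The equation `T f - z f = g` is a recursion for the values of `f`, so that these are controlled
by `f 0` and `g`. -/
theorem exists_abs_apply_le (z : ℝ) (n : ℕ) : ∃ C, 0 ≤ C ∧ ∀ f : (birthDeath α).domain, ∀ k ≤ n,
    |(f : lp (fun _ : ℕ => ℝ) 2) k| ≤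
      C * (|(f : lp (fun _ : ℕ => ℝ) 2) 0| + ‖shift (birthDeath α) z f‖) := by
  induction n with
  | zero =>
    refine ⟨1, zero_le_one, fun f k hk => ?_⟩
    rw [Nat.le_zero.1 hk, one_mul]
    linarith [norm_nonneg (shift (birthDeath α) z f)]
  | succ n ih =>
    obtain ⟨C, hC0, hC⟩ := ih
    set a := edgeWeight α n with ha
    have ha0 : 0 < a := edgeWeight_pos α n
    refine ⟨C + (((n : ℝ) + 1) * (1 + |z| * C)) / a, by positivity, fun f k hk => ?_⟩
    set F : ℕ → ℝ := ((f : lp (fun _ : ℕ => ℝ) 2) : ℕ → ℝ) with hF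
    set X := |F 0| + ‖shift (birthDeath α) z f‖ with hX
    have hX0 : 0 ≤ X := by positivity
    have hnn : 0 ≤ (((n : ℝ) + 1) * (1 + |z| * C)) / a * X := by positivity
    rw [add_mul]
    rcases Nat.lt_or_ge n k with hnk | hkn
    · obtain rfl : k = n + 1 := by omega
      have h1 : flux α F n = ∑ k ∈ Finset.range (n + 1),
          ((shift (birthDeath α) z f : ℕ → ℝ) k + z * F k) := by
        rw [← sum_laplacian]
        refine Finset.sum_congr rfl fun k _ => ?_
        rw [shift_apply, lp.coeFn_sub, lp.coeFn_smul, Pi.sub_apply, Pi.smul_apply, smul_eq_mul,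
          birthDeath_apply]
        ring
      have h2 : |flux α F n| ≤ ((n : ℝ) + 1) * ((1 + |z| * C) * X) := by
        rw [h1]
        refine (Finset.abs_sum_le_sum_abs _ _).trans ?_
        refine (Finset.sum_le_card_nsmul _ _ ((1 + |z| * C) * X) fun k hk => ?_).trans ?_
        · have h3 : |(shift (birthDeath α) z f : ℕ → ℝ) k| ≤ X :=
            (lp.norm_apply_le_norm two_ne_zero (shift (birthDeath α) z f) k).trans
              (le_add_of_nonneg_left (abs_nonneg _))
          have h4 := hC f k (by simpa [Nat.lt_succ_iff] using hk)
          have h5 := mul_le_mul_of_nonneg_left h4 (abs_nonneg z)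
          refine (abs_add_le _ _).trans ?_
          rw [abs_mul]
          change |z| * |F k| ≤ |z| * (C * X) at h5
          linarith
        · rw [Finset.card_range, nsmul_eq_mul]
          push_cast
          exact le_rfl
      have h3 : F (n + 1) = F n - flux α F n / a := by
        rw [flux, ← ha]; field_simp; ring
      rw [h3]
      refine (abs_sub _ _).trans (add_le_add (hC f n le_rfl) ?_)
      rw [abs_div, abs_of_pos ha0, div_mul_eq_mul_div, mul_assoc]
      gcongr
    · have := hC f k hkn
      change |F k| ≤ C * X at this
      linarith

/-- An eigenvector is determined by its value at `0`. -/
theorem eq_zero_of_apply_zero {z : ℝ} {f : (birthDeath α).domain}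
    (hf : shift (birthDeath α) z f = 0) (h0 : (f : lp (fun _ : ℕ => ℝ) 2) 0 = 0) : f = 0 := by
  refine Subtype.ext (lp.ext (funext fun n => ?_))
  obtain ⟨C, -, hC⟩ := exists_abs_apply_le (α := α) z n
  have := hC f n le_rfl
  rw [hf, h0, norm_zero, abs_zero, add_zero, mul_zero] at this
  exact abs_nonpos_iff.1 this

theorem finiteDimensional_eigenspace (α z : ℝ) :
    FiniteDimensional ℝ (eigenspace (birthDeath α) z) := by
  let φ : eigenspace (birthDeath α) z →ₗ[ℝ] ℝ :=
    (lp.evalCLM ℝ (fun _ : ℕ => ℝ) 2 0).toLinearMap ∘ₗ (birthDeath α).domain.subtype ∘ₗ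
      (eigenspace (birthDeath α) z).subtype
  refine FiniteDimensional.of_injective φ ?_
  rw [← LinearMap.ker_eq_bot, LinearMap.ker_eq_bot']
  intro v hv
  exact Subtype.ext (eq_zero_of_apply_zero (z := z) (LinearMap.mem_ker.1 v.2) hv)

end Hardy

/-! ### Discreteness of the spectrum for positive exponents -/

section Discrete

open Filter Topology
open scoped RealInnerProductSpace

/-- If a functional and `T - z` together control the norm, then points of the spectrum are
eigenvalues: approximate eigenvectors normalised by the functional form a Cauchy sequence. -/
theorem exists_eigenvector_of_bound {H : Type*} [NormedAddCommGroup H] [InnerProductSpace ℝ H]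
    [CompleteSpace H] {T : H →ₗ.[ℝ] H} (hT : IsSelfAdjoint T) {z C : ℝ} (ℓ : H →L[ℝ] ℝ)
    (hC : ∀ f : T.domain, ‖(f : H)‖ ≤ C * (|ℓ f| + ‖shift T z f‖)) (hz : z ∈ spectrum T) :
    ∃ v : T.domain, shift T z v = 0 ∧ v ≠ 0 := by
  set D := |C| + 1
  have hD0 : 0 < D := by positivity
  have hbd : ∀ f : T.domain, ‖(f : H)‖ ≤ D * (|ℓ f| + ‖shift T z f‖) := fun f => by
    refine (hC f).trans (mul_le_mul_of_nonneg_right ?_ (by positivity))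
    linarith [le_abs_self C]
  have hex : ∀ ε : ℝ, 0 < ε → ∃ g : T.domain, ℓ g = 1 ∧ ‖shift T z g‖ ≤ ε := fun ε hε => by
    set δ := min (1 / (2 * D)) (ε / (2 * D)) with hδ
    have hδ0 : 0 < δ := by positivity
    obtain ⟨f, hf⟩ := exists_shift_lt_of_mem_spectrum hT hz hδ0
    have h1 := hbd f
    have h2 : δ * D ≤ 1 / 2 := by
      calc δ * D ≤ 1 / (2 * D) * D := by gcongr; exact min_le_left _ _
        _ = 1 / 2 := by field_simp
    have h3 : δ * (2 * D) ≤ ε := by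
      calc δ * (2 * D) ≤ ε / (2 * D) * (2 * D) := by gcongr; exact min_le_right _ _
        _ = ε := by field_simp
    have h4 : ‖(f : H)‖ ≤ 2 * D * |ℓ f| := by nlinarith [norm_nonneg (f : H)]
    have h5 : ℓ f ≠ 0 := fun h => by
      rw [h, abs_zero, mul_zero] at h4
      rw [le_antisymm h4 (norm_nonneg _), mul_zero] at hf
      exact absurd hf (norm_nonneg _).not_gt
    have h6 : 0 < |ℓ f| := abs_pos.2 h5
    refine ⟨(ℓ f)⁻¹ • f, ?_, ?_⟩
    · rw [Submodule.coe_smul, map_smul, smul_eq_mul, inv_mul_cancel₀ h5]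
    · rw [map_smul, norm_smul, norm_inv, Real.norm_eq_abs, inv_mul_le_iff₀ h6]
      calc ‖shift T z f‖ ≤ δ * (2 * D * |ℓ f|) := hf.le.trans (by gcongr)
        _ = δ * (2 * D) * |ℓ f| := by ring
        _ ≤ |ℓ f| * ε := by rw [mul_comm]; gcongr
  choose! g hg1 hg2 using hex
  set η : ℕ → ℝ := fun n => 1 / ((n : ℝ) + 1) with hη
  have hη0 : ∀ n, 0 < η n := fun n => by positivity
  have hηt : Tendsto η atTop (𝓝 0) := tendsto_one_div_add_atTop_nhds_zero_nat
  have hcau : CauchySeq fun n => (g (η n) : H) := by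
    refine cauchySeq_of_le_tendsto_0 (fun N => D * (η N + η N)) (fun n k N hn hk => ?_)
      (by simpa using (hηt.add hηt).const_mul D)
    have h1 := hbd (g (η n) - g (η k))
    rw [Submodule.coe_sub, map_sub, map_sub, hg1 _ (hη0 n), hg1 _ (hη0 k), sub_self, abs_zero,
      zero_add] at h1
    rw [dist_eq_norm]
    refine h1.trans (mul_le_mul_of_nonneg_left ?_ hD0.le)
    have hanti : ∀ i, N ≤ i → η i ≤ η N := fun i _ => by simp only [hη]; gcongr
    exact (norm_sub_le _ _).trans (add_le_add ((hg2 _ (hη0 n)).trans (hanti n hn))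
      ((hg2 _ (hη0 k)).trans (hanti k hk)))
  obtain ⟨v, hv⟩ := cauchySeq_tendsto_of_complete hcau
  have hS : Tendsto (fun n => shift T z (g (η n))) atTop (𝓝 0) :=
    squeeze_zero_norm (fun n => hg2 _ (hη0 n)) hηt
  obtain ⟨hvd, hv0⟩ := exists_of_tendsto hT hv hS
  refine ⟨⟨v, hvd⟩, hv0, fun h => ?_⟩
  have h1 : Tendsto (fun n => ℓ (g (η n))) atTop (𝓝 (ℓ v)) := (ℓ.continuous.tendsto v).comp hv
  have h2 : ℓ v = 1 := tendsto_nhds_unique h1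
    (tendsto_const_nhds.congr fun n => (hg1 _ (hη0 n)).symm)
  rw [show v = 0 from congrArg Subtype.val h, map_zero] at h2
  exact zero_ne_one h2

theorem tendsto_logPlus_nat : Tendsto (fun n : ℕ => logPlus ((n : ℝ) + 1)) atTop atTop :=
  tendsto_atTop_mono (fun _ => le_max_left _ _) (Real.tendsto_log_atTop.comp
    (tendsto_atTop_add_const_right _ _ tendsto_natCast_atTop_atTop))

variable {α : ℝ}

/-- For `α > 0`, the mass of `f` beyond some `N` is an arbitrarily small fraction of the form. This
is the compactness behind the discreteness of the spectrum. -/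
theorem exists_norm_sq_le (hα : 0 < α) {ε : ℝ} (hε : 0 < ε) :
    ∃ N : ℕ, ∀ f : (birthDeath α).domain, ‖(f : lp (fun _ : ℕ => ℝ) 2)‖ ^ 2
      ≤ ∑ n ∈ Finset.range N, (f : lp (fun _ : ℕ => ℝ) 2) n ^ 2
        + ε * ⟪birthDeath α f, (f : lp (fun _ : ℕ => ℝ) 2)⟫ := by
  obtain ⟨N, hN⟩ := (((tendsto_rpow_atTop hα).comp tendsto_logPlus_nat).eventually_ge_atTop
    (4 / ε)).exists
  refine ⟨N, fun f => (norm_sq_le hα.le f N).trans ?_⟩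
  have h1 : 4 / logPlus ((N : ℝ) + 1) ^ α ≤ ε := by
    rw [div_le_iff₀ (Real.rpow_pos_of_pos (logPlus_pos _) _), ← div_le_iff₀' hε]
    exact hN
  have := mul_le_mul_of_nonneg_right h1 (inner_birthDeath_nonneg f)
  linarith

theorem inner_birthDeath_eq (z : ℝ) (f : (birthDeath α).domain) :
    ⟪birthDeath α f, (f : lp (fun _ : ℕ => ℝ) 2)⟫
      = ⟪shift (birthDeath α) z f, (f : lp (fun _ : ℕ => ℝ) 2)⟫
        + z * ‖(f : lp (fun _ : ℕ => ℝ) 2)‖ ^ 2 := by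
  rw [shift_apply, inner_sub_left, real_inner_smul_left, real_inner_self_eq_norm_sq]
  ring

theorem exists_norm_le (hα : 0 < α) (z : ℝ) : ∃ C, ∀ f : (birthDeath α).domain,
    ‖(f : lp (fun _ : ℕ => ℝ) 2)‖ ≤
      C * (|lp.evalCLM ℝ (fun _ : ℕ => ℝ) 2 0 f| + ‖shift (birthDeath α) z f‖) := by
  obtain ⟨N, hN⟩ := exists_norm_sq_le hα (ε := 1 / (2 * (|z| + 1))) (by positivity)
  obtain ⟨C, hC0, hC⟩ := exists_abs_apply_le (α := α) z N
  refine ⟨2 * N * C ^ 2 + 1, fun f => ?_⟩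
  set X := |lp.evalCLM ℝ (fun _ : ℕ => ℝ) 2 0 (f : lp (fun _ : ℕ => ℝ) 2)|
    + ‖shift (birthDeath α) z f‖ with hX
  set y := ‖(f : lp (fun _ : ℕ => ℝ) 2)‖ with hy
  have hX0 : 0 ≤ X := by positivity
  have hy0 : 0 ≤ y := norm_nonneg _
  have h1 : ∑ n ∈ Finset.range N, (f : lp (fun _ : ℕ => ℝ) 2) n ^ 2 ≤ N * (C * X) ^ 2 := by
    refine (Finset.sum_le_card_nsmul _ _ ((C * X) ^ 2) fun n hn => ?_).trans ?_
    · rw [← sq_abs]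
      exact pow_le_pow_left₀ (abs_nonneg _) (hC f n (Finset.mem_range.1 hn).le) 2
    · rw [Finset.card_range, nsmul_eq_mul]
  have h2 : ⟪birthDeath α f, (f : lp (fun _ : ℕ => ℝ) 2)⟫
      ≤ (|z| + 1) * (X * y + y ^ 2) - y ^ 2 := by
    rw [inner_birthDeath_eq z]
    have h3 := real_inner_le_norm (shift (birthDeath α) z f) (f : lp (fun _ : ℕ => ℝ) 2)
    have h4 : ‖shift (birthDeath α) z f‖ ≤ X := le_add_of_nonneg_left (abs_nonneg _)
    have h5 := mul_le_mul_of_nonneg_right h4 hy0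
    have h6 := mul_le_mul_of_nonneg_right (le_abs_self z) (sq_nonneg y)
    have h7 : 0 ≤ |z| * (X * y) := by positivity
    linarith
  have h3 : y ^ 2 ≤ N * (C * X) ^ 2 + (X * y + y ^ 2) / 2 := by
    have h4 := (hN f).trans (add_le_add h1 (mul_le_mul_of_nonneg_left
      (h2.trans (sub_le_self _ (sq_nonneg y))) (by positivity)))
    have h5 : 1 / (2 * (|z| + 1)) * ((|z| + 1) * (X * y + y ^ 2)) = (X * y + y ^ 2) / 2 := by
      field_simp
    rwa [h5] at h4
  by_contra! hlt
  have h4 : 0 ≤ 2 * (N : ℝ) * C ^ 2 := by positivity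
  have h5 : X ≤ y := by nlinarith
  have h6 := mul_le_mul_of_nonneg_left h5 (mul_nonneg h4 hX0)
  rcases hy0.eq_or_lt' with h0 | hpos
  · nlinarith
  · have h7 := mul_lt_mul_of_pos_right hlt hpos
    nlinarith

/-- For `α > 0` there are finitely many points of the spectrum below any `B`: unit eigenvectors
with eigenvalues at most `B` are orthonormal and keep half of their mass in `{0, …, N - 1}`, so
that Bessel's inequality bounds their number by `2 N`. -/
theorem finite_spectrum_inter (hα : 0 < α) (B : ℝ) :
    (Set.Iio B ∩ spectrum (birthDeath α)).Finite := by
  have hT := isSelfAdjoint_birthDeath α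
  have heig : ∀ z ∈ spectrum (birthDeath α), ∃ v : (birthDeath α).domain,
      shift (birthDeath α) z v = 0 ∧ ‖(v : lp (fun _ : ℕ => ℝ) 2)‖ = 1 := fun z hz => by
    obtain ⟨C, hC⟩ := exists_norm_le hα z
    obtain ⟨v, hv, hne⟩ := exists_eigenvector_of_bound hT _ hC hz
    have h0 : ‖(v : lp (fun _ : ℕ => ℝ) 2)‖ ≠ 0 := fun h => hne (Subtype.ext (norm_eq_zero.1 h))
    refine ⟨‖(v : lp (fun _ : ℕ => ℝ) 2)‖⁻¹ • v, by rw [map_smul, hv, smul_zero], ?_⟩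
    rw [Submodule.coe_smul, norm_smul, norm_inv, norm_norm, inv_mul_cancel₀ h0]
  choose! v hv1 hv2 using heig
  obtain ⟨N, hN⟩ := exists_norm_sq_le hα (ε := 1 / (2 * (|B| + 1))) (by positivity)
  by_contra hinf
  obtain ⟨s, hs, hcard⟩ := Set.Infinite.exists_subset_card_eq hinf (2 * N + 1)
  have horth : Orthonormal ℝ fun z : s => (v z : lp (fun _ : ℕ => ℝ) 2) := by
    refine ⟨fun z => hv2 z (hs z.2).2, fun z w hzw => ?_⟩
    have h1 := shift_symm hT z (v z) (v w)
    have h2 : shift (birthDeath α) z (v w) = ((w : ℝ) - z) • (v w : lp (fun _ : ℕ => ℝ) 2) := by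
      have h3 := hv1 w (hs w.2).2
      rw [shift_apply, sub_eq_zero] at h3
      rw [shift_apply, h3, sub_smul]
    rw [hv1 z (hs z.2).2, inner_zero_left, h2, real_inner_smul_right] at h1
    rcases mul_eq_zero.1 h1.symm with h | h
    · exact absurd (Subtype.ext (sub_eq_zero.1 h).symm) hzw
    · exact h
  have hhalf : ∀ z : s, (1 / 2 : ℝ) ≤
      ∑ n ∈ Finset.range N, (v z : lp (fun _ : ℕ => ℝ) 2) n ^ 2 := fun z => by
    have h1 := hN (v z)
    have hzB : (z : ℝ) < B := (hs z.2).1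
    rw [inner_birthDeath_eq (z : ℝ), hv1 z (hs z.2).2, inner_zero_left, hv2 z (hs z.2).2] at h1
    have h2 : 1 / (2 * (|B| + 1)) * (0 + z * 1 ^ 2) ≤ (1 / 2 : ℝ) := by
      rw [div_mul_eq_mul_div, div_le_iff₀ (by positivity)]
      linarith [le_abs_self B]
    linarith
  have hbes : ∀ n : ℕ, ∑ z : s, (v z : lp (fun _ : ℕ => ℝ) 2) n ^ 2 ≤ 1 := fun n => by
    have h1 := horth.sum_inner_products_le (lp.single 2 n (1 : ℝ)) (s := Finset.univ)
    rw [lp.norm_single (by norm_num)] at h1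
    simpa [lp.inner_single_right] using h1
  have h1 : (s.card : ℝ) * (1 / 2) ≤ N := by
    calc (s.card : ℝ) * (1 / 2) = ∑ z : s, (1 / 2 : ℝ) := by simp
      _ ≤ ∑ z : s, ∑ n ∈ Finset.range N, (v z : lp (fun _ : ℕ => ℝ) 2) n ^ 2 :=
        Finset.sum_le_sum fun z _ => hhalf z
      _ = ∑ n ∈ Finset.range N, ∑ z : s, (v z : lp (fun _ : ℕ => ℝ) 2) n ^ 2 := Finset.sum_comm
      _ ≤ ∑ n ∈ Finset.range N, (1 : ℝ) := Finset.sum_le_sum fun n _ => hbes n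
      _ = N := by simp
  rw [hcard] at h1
  push_cast at h1
  linarith

theorem essSpectrum_eq_empty (hα : 0 < α) : essSpectrum (birthDeath α) = ∅ := by
  rw [Set.eq_empty_iff_forall_notMem]
  rintro z ⟨-, hacc | hinf⟩
  · exact Set.Infinite.of_accPt (hacc.nhds_inter (Iio_mem_nhds (lt_add_one z)))
      (finite_spectrum_inter hα _)
  · exact hinf (finiteDimensional_eigenspace α z)

end Discrete

/-! ### Test functions of low energy -/

section Test

open Filter Topology
open scoped RealInnerProductSpace

/-- The energy density of `x ^ (-1/2)` is at most a quarter of its square. -/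
theorem mul_sq_inv_sqrt_sub_le {x : ℝ} (hx : 0 < x) :
    x ^ 2 * (1 / √x - 1 / √(x + 1)) ^ 2 ≤ 1 / 4 * (1 / x) := by
  set p := √x with hp
  set q := √(x + 1) with hq
  have hp0 : 0 < p := Real.sqrt_pos.2 hx
  have hpq : p ≤ q := Real.sqrt_le_sqrt (by linarith)
  have hq0 : 0 < q := hp0.trans_le hpq
  have hpx : p ^ 2 = x := Real.sq_sqrt hx.le
  have hqx : q ^ 2 = x + 1 := Real.sq_sqrt (by linarith)
  have h1 : 1 / p - 1 / q = 1 / (p * q * (p + q)) := by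
    field_simp
    nlinarith
  have h2 : 1 / (p * q * (p + q)) ≤ 1 / (p * p * (p + p)) := by gcongr
  have h3 : (1 / (p * q * (p + q))) ^ 2 ≤ (1 / (p * p * (p + p))) ^ 2 :=
    pow_le_pow_left₀ (by positivity) h2 2
  rw [h1, ← hpx]
  calc (p ^ 2) ^ 2 * (1 / (p * q * (p + q))) ^ 2
      ≤ (p ^ 2) ^ 2 * (1 / (p * p * (p + p))) ^ 2 := by gcongr
    _ = 1 / 4 * (1 / p ^ 2) := by field_simp; norm_num

theorem sum_inv_sqrt_le (K : ℕ) :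
    ∑ n ∈ Finset.range K, 1 / √((n : ℝ) + 1) ≤ 2 * √(K : ℝ) := by
  induction K with
  | zero => simp
  | succ K ih =>
    rw [Finset.sum_range_succ]
    push_cast
    set p := √(K : ℝ) with hp
    set q := √((K : ℝ) + 1) with hq
    have hp0 : 0 ≤ p := Real.sqrt_nonneg _
    have hq0 : 0 < q := Real.sqrt_pos.2 (by positivity)
    have hpx : p ^ 2 = K := Real.sq_sqrt (by positivity)
    have hqx : q ^ 2 = K + 1 := Real.sq_sqrt (by positivity)
    have h1 : 1 / q ≤ 2 * q - 2 * p := by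
      rw [div_le_iff₀ hq0]
      nlinarith [sq_nonneg (q - p)]
    linarith

/-- The function `max ((n + 1)^(-1/2) - K^(-1/2)) 0`, cut off below `N`. -/
noncomputable def testFun (N K n : ℕ) : ℝ :=
  if n < N then 0 else max (1 / √((n : ℝ) + 1) - 1 / √(K : ℝ)) 0

theorem testFun_of_lt {N K n : ℕ} (h : n < N) : testFun N K n = 0 := if_pos h

theorem testFun_of_ge {N K n : ℕ} (hK : 0 < K) (h : K ≤ n) : testFun N K n = 0 := by
  rw [testFun]
  split_ifs
  · rfl
  · refine max_eq_right (sub_nonpos.2 ?_)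
    have h1 : (K : ℝ) ≤ (n : ℝ) + 1 := by
      have : (K : ℝ) ≤ n := by exact_mod_cast h
      linarith
    have h2 : 0 < √(K : ℝ) := Real.sqrt_pos.2 (by exact_mod_cast hK)
    gcongr

theorem testFun_nonneg (N K n : ℕ) : 0 ≤ testFun N K n := by
  rw [testFun]
  split_ifs
  · exact le_rfl
  · exact le_max_right _ _

theorem testFun_le_one (N K n : ℕ) : testFun N K n ≤ 1 := by
  rw [testFun]
  split_ifs
  · exact zero_le_one
  · refine max_le ?_ zero_le_one
    have h1 : 1 / √((n : ℝ) + 1) ≤ 1 := by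
      rw [div_le_one (Real.sqrt_pos.2 (by positivity))]
      exact Real.one_le_sqrt.2 (by linarith [(Nat.cast_nonneg n : (0 : ℝ) ≤ n)])
    have h2 : 0 ≤ 1 / √(K : ℝ) := by positivity
    linarith

/-- The jump at `N` costs at most `N²`, and the decay of the test function at most a quarter of the
harmonic sum. -/
theorem energy_testFun_le (N K : ℕ) :
    ∑ n ∈ Finset.range K, ((n : ℝ) + 1) ^ 2 * (testFun N K n - testFun N K (n + 1)) ^ 2
      ≤ 1 / 4 * ∑ n ∈ Finset.range K, 1 / ((n : ℝ) + 1) + (N : ℝ) ^ 2 := by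
  have hterm : ∀ n : ℕ, ((n : ℝ) + 1) ^ 2 * (testFun N K n - testFun N K (n + 1)) ^ 2
      ≤ 1 / 4 * (1 / ((n : ℝ) + 1)) + if n = N - 1 then (N : ℝ) ^ 2 else 0 := fun n => by
    have hpos : 0 ≤ 1 / 4 * (1 / ((n : ℝ) + 1)) := by positivity
    have hite : 0 ≤ if n = N - 1 then (N : ℝ) ^ 2 else 0 := by split_ifs <;> positivity
    rcases lt_trichotomy (n + 1) N with h | h | h
    · rw [testFun_of_lt (by omega), testFun_of_lt h]
      simpa using add_nonneg hpos hite
    -- the jump at `N`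
    · rw [if_pos (by omega), testFun_of_lt (by omega), ← h]
      have h1 := testFun_nonneg (n + 1) K (n + 1)
      have h2 := testFun_le_one (n + 1) K (n + 1)
      have h3 : (0 - testFun (n + 1) K (n + 1)) ^ 2 ≤ 1 := by nlinarith
      have h4 := mul_le_mul_of_nonneg_left h3 (sq_nonneg ((n : ℝ) + 1))
      push_cast
      linarith
    · refine le_trans ?_ (le_add_of_nonneg_right hite)
      refine le_trans ?_ (mul_sq_inv_sqrt_sub_le (x := (n : ℝ) + 1) (by positivity))
      refine mul_le_mul_of_nonneg_left ?_ (sq_nonneg _)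
      rw [testFun, if_neg (by omega), testFun, if_neg (by omega)]
      -- truncation is a contraction
      rw [sq_le_sq]
      refine (abs_max_sub_max_le_abs _ _ _).trans (le_of_eq ?_)
      push_cast
      congr 1
      ring
  refine (Finset.sum_le_sum fun n _ => hterm n).trans ?_
  rw [Finset.sum_add_distrib, ← Finset.mul_sum, Finset.sum_ite_eq']
  split_ifs
  · exact le_rfl
  · simp

theorem le_sum_testFun_sq (N K : ℕ) :
    ∑ n ∈ Finset.range K, 1 / ((n : ℝ) + 1) - (N + 4)
      ≤ ∑ n ∈ Finset.range K, testFun N K n ^ 2 := by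
  have hterm : ∀ n ∈ Finset.range K, 1 / ((n : ℝ) + 1)
      - 2 * (1 / √((n : ℝ) + 1)) * (1 / √(K : ℝ)) - (if n < N then 1 else 0)
      ≤ testFun N K n ^ 2 := fun n hn => by
    set s := 1 / √((n : ℝ) + 1) with hs
    set t := 1 / √(K : ℝ) with ht
    have hs2 : 1 / ((n : ℝ) + 1) = s ^ 2 := by
      rw [hs, div_pow, one_pow, Real.sq_sqrt (by positivity)]
    have hs0 : 0 ≤ s := by positivity
    have ht0 : 0 ≤ t := by positivity
    rw [hs2, testFun]
    split_ifs with h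
    · have h1 : s ^ 2 ≤ 1 := by
        rw [← hs2, div_le_one (by positivity)]
        linarith [(Nat.cast_nonneg n : (0 : ℝ) ≤ n)]
      have h2 : 0 ≤ s * t := mul_nonneg hs0 ht0
      nlinarith
    · have h1 : (K : ℝ) ≥ (n : ℝ) + 1 := by
        have := Finset.mem_range.1 hn
        exact_mod_cast this
      have h2 : t ≤ s := by rw [hs, ht]; gcongr
      rw [← hs, max_eq_left (sub_nonneg.2 h2)]
      nlinarith [sq_nonneg t]
  refine le_trans ?_ (Finset.sum_le_sum hterm)
  rw [Finset.sum_sub_distrib, Finset.sum_sub_distrib, ← Finset.sum_mul, ← Finset.mul_sum]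
  have h1 : (∑ n ∈ Finset.range K, if n < N then (1 : ℝ) else 0) ≤ N := by
    rw [Finset.sum_ite, Finset.sum_const_zero, add_zero, Finset.sum_const, nsmul_one]
    have : ((Finset.range K).filter (· < N)).card ≤ (Finset.range N).card :=
      Finset.card_le_card fun n hn => Finset.mem_range.2 (Finset.mem_filter.1 hn).2
    rw [Finset.card_range] at this
    exact_mod_cast this
  have h2 : 2 * (∑ n ∈ Finset.range K, 1 / √((n : ℝ) + 1)) * (1 / √(K : ℝ)) ≤ 4 := by
    rcases Nat.eq_zero_or_pos K with h0 | hpos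
    · subst h0; simp
    · have h3 : 0 < √(K : ℝ) := Real.sqrt_pos.2 (by exact_mod_cast hpos)
      rw [mul_one_div, div_le_iff₀ h3]
      linarith [sum_inv_sqrt_le K]
  linarith

/-- The constant `1/4` in Hardy's inequality is sharp, even for functions supported far away: the
harmonic series dominates the cost of the two cut-offs. -/
theorem exists_testFun (N : ℕ) {δ : ℝ} (hδ : 0 < δ) :
    ∃ K, 0 < K ∧ 0 < ∑ n ∈ Finset.range K, testFun N K n ^ 2 ∧
      ∑ n ∈ Finset.range K, ((n : ℝ) + 1) ^ 2 * (testFun N K n - testFun N K (n + 1)) ^ 2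
        ≤ (1 / 4 + δ) * ∑ n ∈ Finset.range K, testFun N K n ^ 2 := by
  set C : ℝ := 1 / 4 * ((N : ℝ) + 4) + (N : ℝ) ^ 2 with hC
  obtain ⟨K, hK, hK0⟩ := ((Real.tendsto_sum_range_one_div_nat_succ_atTop.eventually_ge_atTop
    (C / δ + (N + 4) + 1)).and (eventually_gt_atTop 0)).exists
  have h1 := le_sum_testFun_sq N K
  have h2 := energy_testFun_le N K
  have hC0 : 0 ≤ C := by positivity
  have h3 : 0 ≤ C / δ := by positivity
  have h4 : C / δ + 1 ≤ ∑ n ∈ Finset.range K, testFun N K n ^ 2 := by linarith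
  have h5 : C ≤ δ * ∑ n ∈ Finset.range K, testFun N K n ^ 2 := by
    rw [← div_le_iff₀' hδ]; linarith
  refine ⟨K, hK0, by linarith, ?_⟩
  linarith

end Test

/-! ### The bottom of the essential spectrum -/

section Bottom

open Filter Topology
open scoped RealInnerProductSpace

variable {α : ℝ}

/-- For a finitely supported `h`, Green's formula identifies the energy with the form of the
operator; the vanishing at `0` is what `mem_essSpectrum_of_energy` asks of test vectors. -/
theorem exists_domain_of_energy {h : ℕ → ℝ} {K : ℕ} {M : ℝ} (h0 : h 0 = 0)
    (hK : ∀ n, K ≤ n → h n = 0) (hpos : 0 < ∑ n ∈ Finset.range K, h n ^ 2)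
    (hE : ∑ n ∈ Finset.range K, edgeWeight α n * (h n - h (n + 1)) ^ 2
      ≤ M * ∑ n ∈ Finset.range K, h n ^ 2) :
    ∃ f : (birthDeath α).domain, (f : lp (fun _ : ℕ => ℝ) 2) ≠ 0 ∧
      lp.evalCLM ℝ (fun _ : ℕ => ℝ) 2 0 (f : lp (fun _ : ℕ => ℝ) 2) = 0 ∧
      ⟪birthDeath α f, (f : lp (fun _ : ℕ => ℝ) 2)⟫
        ≤ M * ‖(f : lp (fun _ : ℕ => ℝ) 2)‖ ^ 2 := by
  let F : lp (fun _ : ℕ => ℝ) 2 := ⟨h, memℓp_of_forall_ge hK⟩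
  have hnorm : ‖F‖ ^ 2 = ∑ n ∈ Finset.range K, h n ^ 2 :=
    (hasSum_sq F).unique (hasSum_sum_of_ne_finset_zero fun n hn => by
      change h n ^ 2 = 0
      rw [hK n (by simpa using hn)]
      simp)
  refine ⟨⟨F, mem_domain_of_forall_ge (K := K) hK⟩, fun hF => ?_, h0, ?_⟩
  · change F = 0 at hF
    rw [hF] at hnorm
    simp only [norm_zero] at hnorm
    linarith
  · rw [inner_birthDeath_of_forall_ge (K := K) F _ hK, sum_laplacian_mul]
    change ∑ n ∈ Finset.range K, edgeWeight α n * ((h n - h (n + 1)) * (h n - h (n + 1)))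
      + flux α h K * h K ≤ M * ‖F‖ ^ 2
    rw [hnorm, hK K le_rfl, mul_zero, add_zero]
    simpa only [sq] using hE

/-- Hardy's inequality as a lower bound for the operator. -/
theorem quarter_le_form (f : (birthDeath 0).domain) :
    0 ≤ ⟪shift (birthDeath 0) (1 / 4) f, (f : lp (fun _ : ℕ => ℝ) 2)⟫ := by
  have h1 := inner_birthDeath_eq (1 / 4) f
  have h2 := norm_sq_le_four_mul f
  linarith

theorem quarter_mem_essSpectrum : (1 / 4 : ℝ) ∈ essSpectrum (birthDeath 0) := by
  refine mem_essSpectrum_of_energy (isSelfAdjoint_birthDeath 0) quarter_le_form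
    (lp.evalCLM ℝ (fun _ : ℕ => ℝ) 2 0) (fun v hv h0 => eq_zero_of_apply_zero hv h0)
    fun δ hδ => ?_
  obtain ⟨K, hK, hpos, hE⟩ := exists_testFun 1 hδ
  obtain ⟨f, hf0, hf1, hf2⟩ := exists_domain_of_energy (α := 0) (M := 1 / 4 + δ)
    (testFun_of_lt one_pos) (fun n hn => testFun_of_ge hK hn) hpos (by simpa [edgeWeight] using hE)
  refine ⟨f, hf0, hf1, ?_⟩
  have h1 := inner_birthDeath_eq (1 / 4) f
  linarith

theorem zero_le_form (f : (birthDeath α).domain) :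
    0 ≤ ⟪shift (birthDeath α) 0 f, (f : lp (fun _ : ℕ => ℝ) 2)⟫ := by
  have h1 := inner_birthDeath_eq 0 f
  have h2 := inner_birthDeath_nonneg f
  linarith

theorem zero_mem_essSpectrum (hα : α < 0) : (0 : ℝ) ∈ essSpectrum (birthDeath α) := by
  refine mem_essSpectrum_of_energy (isSelfAdjoint_birthDeath α) zero_le_form
    (lp.evalCLM ℝ (fun _ : ℕ => ℝ) 2 0) (fun v hv h0 => eq_zero_of_apply_zero hv h0)
    fun δ hδ => ?_
  -- the weights beyond `N` are at most `δ / 2` times those for `α = 0`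
  obtain ⟨N, hN⟩ : ∃ N : ℕ, logPlus ((N : ℝ) + 1) ^ α ≤ δ / 2 := by
    have h1 := (tendsto_rpow_neg_atTop (neg_pos.2 hα)).comp tendsto_logPlus_nat
    obtain ⟨N, hN⟩ := (h1.eventually_le_const (half_pos hδ)).exists
    exact ⟨N, by simpa using hN⟩
  obtain ⟨K, hK, hpos, hE⟩ := exists_testFun (N + 1) (δ := 1) one_pos
  set h := testFun (N + 1) K with hh
  have hE' : ∑ n ∈ Finset.range K, edgeWeight α n * (h n - h (n + 1)) ^ 2
      ≤ δ * ∑ n ∈ Finset.range K, h n ^ 2 := by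
    calc ∑ n ∈ Finset.range K, edgeWeight α n * (h n - h (n + 1)) ^ 2
        ≤ ∑ n ∈ Finset.range K, δ / 2 * (((n : ℝ) + 1) ^ 2 * (h n - h (n + 1)) ^ 2) := by
          refine Finset.sum_le_sum fun n _ => ?_
          rcases Nat.lt_or_ge n N with hn | hn
          · rw [hh, testFun_of_lt (by omega), testFun_of_lt (by omega)]
            simp
          · have h1 : logPlus ((n : ℝ) + 1) ^ α ≤ δ / 2 := by
              refine le_trans (Real.rpow_le_rpow_of_nonpos (logPlus_pos _)
                (logPlus_mono (by positivity) ?_) hα.le) hN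
              have : (N : ℝ) ≤ n := by exact_mod_cast hn
              linarith
            rw [edgeWeight]
            calc ((n : ℝ) + 1) ^ 2 * logPlus ((n : ℝ) + 1) ^ α * (h n - h (n + 1)) ^ 2
                = logPlus ((n : ℝ) + 1) ^ α * (((n : ℝ) + 1) ^ 2 * (h n - h (n + 1)) ^ 2) := by ring
              _ ≤ _ := by gcongr
      _ ≤ δ / 2 * ((1 / 4 + 1) * ∑ n ∈ Finset.range K, h n ^ 2) := by
          rw [← Finset.mul_sum]; gcongr
      _ ≤ δ * ∑ n ∈ Finset.range K, h n ^ 2 := by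
          have := mul_pos hδ hpos
          linarith
  obtain ⟨f, hf0, hf1, hf2⟩ := exists_domain_of_energy (α := α) (testFun_of_lt (Nat.succ_pos N))
    (fun n hn => testFun_of_ge hK hn) hpos hE'
  refine ⟨f, hf0, hf1, ?_⟩
  have h1 := inner_birthDeath_eq 0 f
  linarith

theorem bottom_le {S : Set ℝ} {z : ℝ} (hz : z ∈ S) : bottom S ≤ z :=
  sInf_le (Set.mem_image_of_mem _ hz)

theorem le_bottom {S : Set ℝ} {m : ℝ} (h : ∀ z ∈ S, m ≤ z) : (m : EReal) ≤ bottom S := by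
  refine le_sInf ?_
  rintro _ ⟨z, hz, rfl⟩
  exact EReal.coe_le_coe_iff.2 (h z hz)

end Bottom

end GraphLaplacian

theorem mainTheorem6 :
    -- the Hardy-type inequality for finitely supported functions
    (∀ f : ℕ →₀ ℝ,
      (1 / 9 : ℝ) * ∑' n : ℕ, f n ^ 2 ≤ ∑' n : ℕ, ((n : ℝ) + 1) ^ 2 * (f n - f (n + 1)) ^ 2) ∧
    -- the case `α = 0`
    (((1 / 9 : ℝ) : EReal) ≤ GraphLaplacian.lambdaZero 0 ∧
      GraphLaplacian.lambdaZero 0 ≤ GraphLaplacian.lambdaZeroEss 0 ∧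
      GraphLaplacian.lambdaZeroEss 0 ≤ ((1 / 4 : ℝ) : EReal)) ∧
    -- the case `0 < α < 2`
    (∀ α : ℝ, 0 < α → α < 2 → GraphLaplacian.essSpectrum (GraphLaplacian.birthDeath α) = ∅) ∧
    -- the case `α < 0`
    (∀ α : ℝ, α < 0 → GraphLaplacian.lambdaZeroEss α = 0) := by
  refine ⟨GraphLaplacian.hardy_finsupp, ⟨GraphLaplacian.le_bottom fun z hz => ?_,
    sInf_le_sInf (Set.image_mono fun z hz => hz.1),
    GraphLaplacian.bottom_le GraphLaplacian.quarter_mem_essSpectrum⟩,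
    fun α hα _ => GraphLaplacian.essSpectrum_eq_empty hα,
    fun α hα => le_antisymm (GraphLaplacian.bottom_le (GraphLaplacian.zero_mem_essSpectrum hα))
      (GraphLaplacian.le_bottom fun z hz => ?_)⟩
  · have := GraphLaplacian.le_of_mem_spectrum (GraphLaplacian.isSelfAdjoint_birthDeath 0)
      GraphLaplacian.quarter_le_form hz
    linarith
  · exact GraphLaplacian.le_of_mem_spectrum (GraphLaplacian.isSelfAdjoint_birthDeath α)
      GraphLaplacian.zero_le_form hz.1
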